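/- Conventions. Let $\Phi$ be an indecomposable finite (reduced, crystallographic) root system with basis $\Delta$. A root is called short if it has minimal length (all roots are short if there is only one root length), and the invariant scalar product on $\mathbf R\Phi$ is normalised by $(\alpha,\alpha)=2$ for short $\alpha$. For $x=\sum_{\alpha\in\Delta}m_\alpha\alpha$ put $\operatorname{supp}x=\{\alpha\mid m_\alpha\neq0\}$. Let $\beta_1$ be the largest short root. The extended Dynkin diagram has vertices $\Delta\cup\{\alpha_0\}$, where $\alpha_0$ is linked to the simple roots as $-\beta_1$ is. Put $\mathbf R\Phi^{\rm aff}=\mathbf R\alpha_0\oplus\mathbf R\Phi$ and $\delta=\alpha_0+\beta_1$, and extend the form by $(\delta,\cdot)=0$. The Kostant cascade $\mathcal K$ is constructed as follows: start with the subset $S=\Delta$; for each subset $S$ obtained for which $\Phi\cap\mathbf ZS$ contains short roots of $\Phi$, let $\beta$ be the largest short root in $\Phi\cap\mathbf ZS$, and continue with the connected components of $\{\alpha\in S\mid(\beta,\alpha)=0\}$; $\mathcal K$ is the set of all $\beta$ obtained. An element $\beta\in\mathcal K$ is a predecessor of $\beta'\in\mathcal K$ if $\operatorname{supp}\beta'$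 is a connected component of $\operatorname{supp}\beta\setminus\{\alpha\in\operatorname{supp}\beta\mid(\beta,\alpha)>0\}$. Proposition 26. Let $\Phi_1,\Phi_2$ be two such root systems with bases $\Delta_1,\Delta_2$, largest short roots $\beta_1,\beta_1'$, extra vertices $\alpha_0,\alpha_0'$, $\delta=\alpha_0+\beta_1$, $\delta'=\alpha_0'+\beta_1'$, and Kostant cascades $\mathcal K_1,\mathcal K_2$. Let $I_i\subsetneq\Delta_i$ be proper subsets such that $I_1\cup\{\alpha_0\}$ and $I_2\cup\{\alpha_0'\}$ are connected subsets of the extended Dynkin diagrams, and let $f:I_1\cup\{\alpha_0\}\to I_2\cup\{\alpha_0'\}$ be a bijection with $f(\alpha_0)=\alpha_0'$ that is an isomorphism of Dynkin diagrams; extend $f$ linearly to $\mathbf R(I_1\cup\{\alpha_0\})\to\mathbf R(I_2\cup\{\alpha_0'\})$. Let $\Psi_1$ be the set of short roots $\beta\in\Phi_1$ with $\operatorname{supp}(\beta_1-\beta)\subset I_1$, and $\Psi_2$ the set of short roots $\gamma\in\Phi_2$ with $\operatorname{supp}(\beta_1'-\gamma)\subset I_2$. Then $\tau(\beta)=\delta'-f(\delta-\beta)$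 defines a bijection $\tau:\Psi_1\to\Psi_2$ such that (i) $(\tau(\beta),f(\alpha))=(\beta,\alpha)$ and $(\tau(\beta),\tau(\beta'))=(\beta,\beta')$ for all $\beta,\beta'\in\Psi_1$ and $\alpha\in I_1\cup\{\alpha_0\}$; (ii) $\tau(\mathcal K_1\cap\Psi_1)=\mathcal K_2\cap\Psi_2$; (iii) for $\beta,\beta'\in\mathcal K_1\cap\Psi_1$, $\beta$ is a predecessor of $\beta'$ in $\mathcal K_1$ if and only if $\tau(\beta)$ is a predecessor of $\tau(\beta')$ in $\mathcal K_2$; moreover $\mathcal K_1\cap\Psi_1$ consists of distinct elements $\beta^{(0)}=\beta_1,\beta^{(1)},\dots,\beta^{(r)}$ such that each $\beta^{(j)}$ with $j<r$ is a predecessor of $\beta^{(j+1)}$ in $\mathcal K_1$, each $\tau(\beta^{(j)})$ with $j<r$ is a predecessor of $\tau(\beta^{(j+1)})$ in $\mathcal K_2$, and $\tau(\beta^{(0)})=\beta_1'$. -/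

import Mathlib

namespace KostantCascade

noncomputable section

/-! Throughout, a finite root system `Φ` in the real vector space `M = ℝΦ` is a
`P : RootPairing ι ℝ M N` with `P.IsRootSystem`; roots are referred to through their indices in `ι`
(`P.root : ι ↪ M` is injective), and `P.pairing i j` is `(α_i, α_j^∨)`.  The basis `Δ` is
`b : P.Base`, and its elements are the members of the finite type `b.support`. -/

section FiniteRootSystem

variable {ι M N : Type*} [Fintype ι] [AddCommGroup M] [Module ℝ M] [AddCommGroup N] [Module ℝ N]

/-- A root is short if it has minimal length among all roots (for the canonical Weyl group invariant
scalar product).  If all roots have the same length, all of them are short. -/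
def IsShort (P : RootPairing ι ℝ M N) (i : ι) : Prop :=
  ∀ j : ι, P.RootForm (P.root i) (P.root i) ≤ P.RootForm (P.root j) (P.root j)

/-- The Weyl group invariant scalar product on `ℝΦ`, rescaled so that `(β, β) = 2` for the root with
index `β`. It is used for short `β` only, so that all short roots satisfy `(α, α) = 2`. -/
def normForm (P : RootPairing ι ℝ M N) (β : ι) : LinearMap.BilinForm ℝ M :=
  (2 / P.RootForm (P.root β) (P.root β)) • P.RootForm

variable {P : RootPairing ι ℝ M N}

/-- The usual order on `ℝΦ`: `x ≤ y` iff `y - x` is a sum of simple roots. -/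
def RootLE (b : P.Base) (x y : M) : Prop :=
  y - x ∈ AddSubmonoid.closure (P.root '' (b.support : Set ι))

/-- The Dynkin diagram of `Φ` as a graph on the simple roots (bond types are forgotten). -/
def dynkinGraph (b : P.Base) : SimpleGraph b.support :=
  SimpleGraph.fromRel fun i j => P.pairing i j ≠ 0

/-- `T` is (the vertex set of) a connected component of the full subgraph of `G` on `A`. -/
def IsComponent {V : Type*} (G : SimpleGraph V) (A T : Set V) : Prop :=
  T ⊆ A ∧ (G.induce T).Connected ∧
    ∀ T' : Set V, T ⊆ T' → T' ⊆ A → (G.induce T').Connected → T' = T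

variable [P.IsRootSystem]

/-- The support of `x = ∑ m_α α` is `{α ∈ Δ | m_α ≠ 0}`. -/
def supp (b : P.Base) (x : M) : Set b.support :=
  {i | b.toWeightBasis.repr x i ≠ 0}

/-- The root `β` is the largest short root in `Φ ∩ ℤS`, where `S ⊆ Δ`
(a root lies in `ℤS` iff its support is contained in `S`). -/
def IsLargestShortRoot (b : P.Base) (S : Set b.support) (β : ι) : Prop :=
  (IsShort P β ∧ supp b (P.root β) ⊆ S) ∧
    ∀ γ : ι, IsShort P γ → supp b (P.root γ) ⊆ S → RootLE b (P.root γ) (P.root β)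

/-- The subsets of `Δ` that occur in the construction of the Kostant cascade: `Δ` itself, and with
`S` also each connected component of `{α ∈ S | (β, α) = 0}`, where `β` is the largest short
root in `Φ ∩ ℤS`.  (Subsets without short roots are not decomposed any further.) -/
inductive IsCascadeSet (b : P.Base) : Set b.support → Prop
  | top : IsCascadeSet b Set.univ
  | step (S T : Set b.support) (β : ι) (hS : IsCascadeSet b S) (hβ : IsLargestShortRoot b S β)
      (hT : IsComponent (dynkinGraph b) {α | α ∈ S ∧ P.pairing β α = 0} T) : IsCascadeSet b T

/-- The Kostant cascade: all the largest short roots encountered in the construction. -/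
def cascade (b : P.Base) : Set ι :=
  {β | ∃ S : Set b.support, IsCascadeSet b S ∧ IsLargestShortRoot b S β}

/-- `β` is a predecessor of `β'` in the Kostant cascade: `supp β'` is a connected component
of `supp β \ {α ∈ supp β | (β, α) > 0}`. -/
def IsPredecessor (b : P.Base) (β β' : ι) : Prop :=
  β ∈ cascade b ∧ β' ∈ cascade b ∧
    IsComponent (dynkinGraph b)
      (supp b (P.root β) \ {α | α ∈ supp b (P.root β) ∧ 0 < P.pairing β α})
      (supp b (P.root β'))

/-- The set `Ψ` of all short roots `β` with `supp (β₁ - β) ⊆ I`. -/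
def Psi (b : P.Base) (β₁ : ι) (I : Set b.support) : Set ι :=
  {β | IsShort P β ∧ supp b (P.root β₁ - P.root β) ⊆ I}

end FiniteRootSystem

/-! ### The extended Dynkin diagram and the space `ℝΦ^aff`

The vertices of the extended Dynkin diagram `Δ ∪ {α₀}` are the elements of `Option b.support`, where
`none` stands for `α₀`.  The parameter `β₁` is the largest short root. -/

section Affine

variable {ι M N : Type*} [Fintype ι] [AddCommGroup M] [Module ℝ M] [AddCommGroup N] [Module ℝ N]
  {P : RootPairing ι ℝ M N}

/-- The root of `Φ` attached to a vertex of the extended diagram: `-β₁` for `α₀`. -/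
def vertexRoot (b : P.Base) (β₁ : ι) : Option b.support → ι
  | none => P.reflectionPerm β₁ β₁
  | some i => i

/-- The (generalised) Cartan matrix encoding the extended Dynkin diagram with its bonds. -/
def extCartan (b : P.Base) (β₁ : ι) (x y : Option b.support) : ℝ :=
  P.pairing (vertexRoot b β₁ x) (vertexRoot b β₁ y)

/-- The graph underlying the extended Dynkin diagram. -/
def extGraph (b : P.Base) (β₁ : ι) : SimpleGraph (Option b.support) :=
  SimpleGraph.fromRel fun x y => extCartan b β₁ x y ≠ 0

/-- The set of vertices `I ∪ {α₀}` of the extended Dynkin diagram. -/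
def extSet {b : P.Base} (I : Set b.support) : Set (Option b.support) :=
  insert none (some '' I)

/-- The space `ℝΦ^aff = ℝα₀ ⊕ ℝΦ`, with basis the vertices of the extended Dynkin diagram. -/
abbrev AffSpace (b : P.Base) : Type _ := Option b.support →₀ ℝ

/-- The projection of `ℝΦ^aff` onto `ℝΦ` with `α ↦ α` for `α ∈ Δ` and `α₀ ↦ -β₁`, i.e. `δ ↦ 0`. -/
def affProj (b : P.Base) (β₁ : ι) : AffSpace b →ₗ[ℝ] M :=
  Finsupp.linearCombination ℝ fun x => P.root (vertexRoot b β₁ x)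

/-- The extension of the normalised scalar product to `ℝΦ^aff` with `(δ, μ) = 0` for all `μ`. -/
def affForm (b : P.Base) (β₁ : ι) : LinearMap.BilinForm ℝ (AffSpace b) :=
  (normForm P β₁).comp (affProj b β₁) (affProj b β₁)

variable [P.IsRootSystem]

/-- The inclusion of `ℝΦ` into `ℝΦ^aff`. -/
def affIncl (b : P.Base) : M →ₗ[ℝ] AffSpace b :=
  Finsupp.lmapDomain ℝ ℝ some ∘ₗ b.toWeightBasis.repr.toLinearMap

/-- The basic imaginary root `δ = α₀ + β₁`. -/
def delta (b : P.Base) (β₁ : ι) : AffSpace b :=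
  Finsupp.single none 1 + affIncl b (P.root β₁)

/-- For `β ∈ Ψ` the element `δ - β` lies in `ℝ(I ∪ {α₀})`. -/
theorem delta_sub_mem (b : P.Base) (β₁ : ι) (I : Set b.support) (β : Psi b β₁ I) :
    delta b β₁ - affIncl b (P.root β) ∈ Finsupp.supported ℝ ℝ (extSet I) := by
  have h : delta b β₁ - affIncl b (P.root β) =
      Finsupp.single none 1 + affIncl b (P.root β₁ - P.root β) := by
    rw [delta, map_sub]; abel
  rw [h]
  refine Submodule.add_mem _ (Finsupp.single_mem_supported _ _ (Set.mem_insert _ _)) ?_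
  rw [Finsupp.mem_supported]
  intro x hx
  have hx' : x ∈ (Finsupp.mapDomain some
      (b.toWeightBasis.repr (P.root β₁ - P.root β))).support := hx
  classical
  obtain ⟨i, hi, rfl⟩ := Finset.mem_image.1 (Finsupp.mapDomain_support hx')
  exact Set.mem_insert_of_mem _ ⟨i, β.2.2 (Finsupp.mem_support_iff.1 hi), rfl⟩

end Affine

/-- The linear isomorphism `ℝ(I₁ ∪ {α₀}) ≃ ℝ(I₂ ∪ {α₀'})` that extends a bijection `f` between
two sets of vertices of extended Dynkin diagrams. -/
def linExt {V₁ V₂ : Type*} {K₁ : Set V₁} {K₂ : Set V₂} (f : K₁ ≃ K₂) :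
    Finsupp.supported ℝ ℝ K₁ ≃ₗ[ℝ] Finsupp.supported ℝ ℝ K₂ :=
  Finsupp.congr K₁ K₂ f

end

end KostantCascade

/-!
The map `τ` exists because `Ψ` is a single orbit: if `β ∈ Ψ` differs from the largest short root
`β₁`, then some `α ∈ I` has `(β, α) < 0` (otherwise `(β, β₁) ≥ (β, β)`, which forces `β = β₁` as
both have the same length), so reflections in `I` lead from `β` up to `β₁` (`Psi_induction`). The
projection `ℝΦ^aff → ℝΦ` sends `δ - β` to `-β`, and the linear extension of `f` preserves
pairings with the coroots of the vertices of `I ∪ {α₀}`. Hence a reflection in `α ∈ I₁` on one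
side corresponds to the reflection in `f(α)` on the other, and `δ' - f(δ - β)` is again a short
root in `Ψ₂` (`exists_isTransport`). The inverse of `τ` is the same construction for `f⁻¹`. As
`I₁ ∪ {α₀}` is connected, the Cartan matrix determines all lengths from that of `α₀`, so `f` is
an isometry (`normForm_affProj_linExt`). Moreover `τ(β') - τ(β) = f(β' - β)`, so `τ` preserves
the root order on `Ψ` (`IsTransport.rootLE_iff`).

It remains to recover the cascade elements in `Ψ`, and their predecessors, from the order and the
orthogonality relation on `Ψ` alone. All elements of `Ψ` have the nonempty set `Δ \ I` in their
supports, because `β₁` has full support. Cascade sets that meet are nested, the smaller one being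
orthogonal to the largest short root of the larger one (`IsCascadeSet.nested`), so the cascade
elements in `Ψ` form a chain of mutually orthogonal roots. Conversely, let `γ ∈ Ψ` be orthogonal
to every larger cascade element in `Ψ`, and take a minimal cascade set `S` that contains `supp
γ`, with largest short root `β ≥ γ`. If `γ ≠ β`, then `γ` is orthogonal to `β`, so the connected
set `supp γ` lies in a component of `{α ∈ S | (β, α) = 0}`, against the minimality of `S`; hence
`γ = β` is in the cascade. This criterion (`mem_cascade_iff_orthogonal`) determines the cascade
elements in `Ψ` by descending induction, and predecessors are immediate neighbours in the chain
(`isPredecessor_iff`). The underlying fact on root systems is that a connected set of simple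
roots supports at most one dominant short root (`IsShort.eq_of_dominant`), which is then the
largest one.
-/

set_option linter.unusedSectionVars false

namespace KostantCascade

noncomputable section

/-! ### Connected sets of vertices and components -/

section Graph

variable {V : Type*} {G : SimpleGraph V}

/-- A set of vertices is connected iff it is non-empty and admits no cut without edges. -/
theorem induce_connected_iff {T : Set V} : (G.induce T).Connected ↔
    T.Nonempty ∧ ∀ A ⊆ T, A.Nonempty → (∀ a ∈ A, ∀ c ∈ T, c ∉ A → ¬ G.Adj a c) → A = T := by
  constructor
  · intro h
    refine ⟨Set.nonempty_coe_sort.1 h.nonempty, fun A hA ⟨a, ha⟩ hcut => ?_⟩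
    refine hA.antisymm fun t ht => ?_
    by_contra htA
    obtain ⟨p⟩ := h.preconnected ⟨a, hA ha⟩ ⟨t, ht⟩
    obtain ⟨d, -, h1, h2⟩ := p.exists_boundary_dart {x | (x : V) ∈ A} ha htA
    exact hcut _ h1 _ d.snd.2 h2 d.adj
  · rintro ⟨⟨t₀, ht₀⟩, h⟩
    have key : {t | ∃ ht : t ∈ T, (G.induce T).Reachable ⟨t₀, ht₀⟩ ⟨t, ht⟩} = T := by
      refine h _ (fun t ht => ht.1) ⟨t₀, ht₀, SimpleGraph.Reachable.refl _⟩ ?_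
      rintro a ⟨ha, hr⟩ c hc hcA hadj
      refine hcA ⟨hc, hr.trans ?_⟩
      have : (G.induce T).Adj ⟨a, ha⟩ ⟨c, hc⟩ := hadj
      exact this.reachable
    have hr : ∀ t : T, (G.induce T).Reachable ⟨t₀, ht₀⟩ t := by
      rintro ⟨t, ht⟩
      obtain ⟨_, h'⟩ := key.symm.subset ht
      exact h'
    exact (SimpleGraph.connected_iff _).2 ⟨fun x y => (hr x).symm.trans (hr y), ⟨⟨t₀, ht₀⟩⟩⟩

theorem IsComponent.subset_of_connected {A T T' : Set V} (hT : IsComponent G A T)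
    (hT' : (G.induce T').Connected) (hA : T' ⊆ A) (hne : (T ∩ T').Nonempty) : T' ⊆ T := by
  have := hT.2.2 (T ∪ T') Set.subset_union_left (Set.union_subset hT.1 hA)
    (SimpleGraph.induce_union_connected hT.2.1.preconnected hT'.preconnected hne)
  rw [← this]
  exact Set.subset_union_right

theorem exists_isComponent [Finite V] {A T' : Set V} (hT' : (G.induce T').Connected)
    (hA : T' ⊆ A) : ∃ T, T' ⊆ T ∧ IsComponent G A T := by
  obtain ⟨T, hle, hT⟩ := (Set.toFinite
    {T : Set V | T ⊆ A ∧ (G.induce T).Connected}).exists_le_maximal (a := T') ⟨hA, hT'⟩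
  exact ⟨T, hle, hT.prop.1, hT.prop.2, fun S hTS hSA hS =>
    (hT.eq_of_le ⟨hSA, hS⟩ hTS).symm⟩

end Graph

/-! ### The invariant form and short roots -/

section Form

variable {ι M N : Type*} [Fintype ι] [AddCommGroup M] [Module ℝ M] [AddCommGroup N] [Module ℝ N]
variable {P : RootPairing ι ℝ M N}

theorem rootForm_comm (x y : M) : P.RootForm x y = P.RootForm y x :=
  P.rootForm_symmetric.eq x y

theorem two_mul_rootForm_root (x : M) (j : ι) :
    2 * P.RootForm x (P.root j) = P.coroot' j x * P.RootForm (P.root j) (P.root j) := by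
  have h := P.rootForm_reflection_reflection_apply j x (P.root j)
  rw [P.reflection_apply_self, RootPairing.reflection_apply] at h
  simp only [map_sub, map_smul, map_neg, LinearMap.sub_apply, LinearMap.smul_apply,
    smul_eq_mul] at h
  linarith

theorem two_mul_rootForm_root_root (i j : ι) :
    2 * P.RootForm (P.root i) (P.root j) = P.pairing i j * P.RootForm (P.root j) (P.root j) := by
  simpa using two_mul_rootForm_root (P := P) (P.root i) j

theorem rootForm_root_self_pos (i : ι) : 0 < P.RootForm (P.root i) (P.root i) :=
  P.rootForm_pos_of_ne_zero (Submodule.subset_span ⟨i, rfl⟩) (P.ne_zero i)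

theorem rootForm_self_pos [P.IsRootSystem] {x : M} (hx : x ≠ 0) : 0 < P.RootForm x x :=
  P.rootForm_pos_of_ne_zero (by simp) hx

theorem pairing_pos_iff {i j : ι} :
    0 < P.pairing i j ↔ 0 < P.RootForm (P.root i) (P.root j) := by
  have h := two_mul_rootForm_root_root (P := P) i j
  have hp := rootForm_root_self_pos (P := P) j
  rw [← mul_pos_iff_of_pos_right hp, ← h]
  constructor <;> intro <;> linarith

theorem pairing_neg_iff {i j : ι} :
    P.pairing i j < 0 ↔ P.RootForm (P.root i) (P.root j) < 0 := by
  have h := two_mul_rootForm_root_root (P := P) i j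
  have hp := rootForm_root_self_pos (P := P) j
  constructor
  · intro h'
    nlinarith
  · intro h'
    by_contra! h0
    nlinarith

theorem pairing_nonneg_iff {i j : ι} :
    0 ≤ P.pairing i j ↔ 0 ≤ P.RootForm (P.root i) (P.root j) := by
  rw [← not_lt, ← not_lt, pairing_neg_iff]

theorem pairing_eq_zero_iff_rootForm {i j : ι} :
    P.pairing i j = 0 ↔ P.RootForm (P.root i) (P.root j) = 0 := by
  have h := two_mul_rootForm_root_root (P := P) i j
  have hp := rootForm_root_self_pos (P := P) j
  constructor
  · intro h0
    rw [h0] at h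
    linarith
  · intro h0
    rw [h0] at h
    simpa [hp.ne'] using h.symm

theorem pairing_eq_zero_comm {i j : ι} : P.pairing i j = 0 ↔ P.pairing j i = 0 := by
  rw [pairing_eq_zero_iff_rootForm, pairing_eq_zero_iff_rootForm, rootForm_comm]

theorem root_reflectionPerm_eq (k i : ι) :
    P.root (P.reflectionPerm k i) = P.root i - P.pairing i k • P.root k := by
  rw [P.root_reflectionPerm, P.reflection_apply_root]

theorem IsShort.reflectionPerm {i : ι} (hi : IsShort P i) (k : ι) :
    IsShort P (P.reflectionPerm k i) := by
  intro j
  rw [P.root_reflectionPerm, P.rootForm_reflection_reflection_apply]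
  exact hi j

theorem IsShort.rootForm_eq {i j : ι} (hi : IsShort P i) (hj : IsShort P j) :
    P.RootForm (P.root i) (P.root i) = P.RootForm (P.root j) (P.root j) :=
  le_antisymm (hi j) (hj i)

/-- Equality case of the Cauchy-Schwarz inequality for two short roots. -/
theorem IsShort.eq_of_rootForm_le [P.IsRootSystem] {i j : ι} (hi : IsShort P i) (hj : IsShort P j)
    (h : P.RootForm (P.root j) (P.root j) ≤ P.RootForm (P.root i) (P.root j)) : i = j := by
  by_contra hne
  have h0 : P.root i - P.root j ≠ 0 := sub_ne_zero.2 fun h => hne (P.root.injective h)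
  have h1 := rootForm_self_pos (P := P) h0
  simp only [map_sub, LinearMap.sub_apply] at h1
  have h2 := hi.rootForm_eq hj
  have h3 := rootForm_comm (P := P) (P.root i) (P.root j)
  linarith

/-- For distinct short roots at an acute angle; it follows that their difference is a root. -/
theorem IsShort.pairing_eq_one [P.IsRootSystem] [P.IsCrystallographic] {i j : ι}
    (hi : IsShort P i) (hj : IsShort P j) (hne : i ≠ j)
    (h : 0 < P.RootForm (P.root i) (P.root j)) : P.pairing i j = 1 := by
  have h1 : P.RootForm (P.root i) (P.root j) < P.RootForm (P.root j) (P.root j) := by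
    by_contra! h'
    exact hne (hi.eq_of_rootForm_le hj h')
  have h2 := two_mul_rootForm_root_root (P := P) i j
  have hp := rootForm_root_self_pos (P := P) j
  have h3 : 0 < P.pairing i j := pairing_pos_iff.2 h
  have h4 : P.pairing i j < 2 := by
    by_contra! h'
    nlinarith
  rw [← P.algebraMap_pairingIn ℤ] at h3 h4 ⊢
  simp only [algebraMap_int_eq, eq_intCast] at h3 h4 ⊢
  norm_cast at h3 h4 ⊢
  have h5 : P.pairingIn ℤ i j < 2 := by exact_mod_cast h4
  omega

end Form

/-! ### Coefficients on the simple roots, heights and the root order -/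

section Coefficients

variable {ι M N : Type*} [Fintype ι] [AddCommGroup M] [Module ℝ M] [AddCommGroup N] [Module ℝ N]
variable {P : RootPairing ι ℝ M N} [P.IsRootSystem] (b : P.Base)

/-- The coefficient `m_α` of `x = ∑ m_α α` at the simple root `α` with index `k`. -/
def coeff (x : M) (k : b.support) : ℝ := b.toWeightBasis.repr x k

/-- The height of a vector: the sum of its coefficients on the simple roots. -/
def ht (x : M) : ℝ := ∑ k, coeff b x k

@[simp] theorem coeff_zero (k : b.support) : coeff b 0 k = 0 := by simp [coeff]

@[simp] theorem coeff_add (x y : M) (k : b.support) :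
    coeff b (x + y) k = coeff b x k + coeff b y k := by simp [coeff]

@[simp] theorem coeff_neg (x : M) (k : b.support) : coeff b (-x) k = -coeff b x k := by
  simp [coeff]

@[simp] theorem coeff_sub (x y : M) (k : b.support) :
    coeff b (x - y) k = coeff b x k - coeff b y k := by simp [coeff]

@[simp] theorem coeff_smul (c : ℝ) (x : M) (k : b.support) :
    coeff b (c • x) k = c * coeff b x k := by simp [coeff]

theorem coeff_simple [DecidableEq ι] (k m : b.support) :
    coeff b (P.root k) m = if k = m then 1 else 0 := by
  rw [coeff, b.toWeightBasis_repr_root, Finsupp.single_apply]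

theorem sum_coeff_smul (x : M) : ∑ k, coeff b x k • P.root k = x := by
  conv_rhs => rw [← b.toWeightBasis.sum_repr x]
  simp [coeff]

theorem mem_supp {x : M} {k : b.support} : k ∈ supp b x ↔ coeff b x k ≠ 0 := Iff.rfl

theorem coeff_ext {x y : M} (h : ∀ k, coeff b x k = coeff b y k) : x = y :=
  b.toWeightBasis.repr.injective (Finsupp.ext h)

theorem rootForm_eq_sum (x y : M) :
    P.RootForm x y = ∑ k, coeff b y k * P.RootForm x (P.root k) := by
  conv_lhs => rw [← sum_coeff_smul b y]
  simp

theorem coroot'_eq_sum (j : ι) (x : M) :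
    P.coroot' j x = ∑ k, coeff b x k * P.pairing k j := by
  conv_lhs => rw [← sum_coeff_smul b x]
  simp

theorem pairing_eq_sum (i j : ι) :
    P.pairing i j = ∑ k, coeff b (P.root i) k * P.pairing k j := by
  rw [← coroot'_eq_sum]
  simp

theorem mem_closure_iff {x : M} : x ∈ AddSubmonoid.closure (P.root '' (b.support : Set ι)) ↔
    ∀ k, ∃ n : ℕ, coeff b x k = n := by
  classical
  constructor
  · intro h k
    induction h using AddSubmonoid.closure_induction with
    | mem x hx =>
      obtain ⟨i, hi, rfl⟩ := hx
      refine ⟨if (⟨i, hi⟩ : b.support) = k then 1 else 0, ?_⟩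
      rw [coeff_simple b ⟨i, hi⟩ k]
      push_cast
      rfl
    | zero => exact ⟨0, by simp⟩
    | add x y _ _ hx hy =>
      obtain ⟨m, hm⟩ := hx
      obtain ⟨n, hn⟩ := hy
      exact ⟨m + n, by simp [hm, hn]⟩
  · intro h
    rw [← sum_coeff_smul b x]
    refine sum_mem fun k _ => ?_
    obtain ⟨n, hn⟩ := h k
    rw [hn, Nat.cast_smul_eq_nsmul]
    exact nsmul_mem (AddSubmonoid.subset_closure (Set.mem_image_of_mem _ k.2)) n

theorem coeff_root_int (i : ι) (k : b.support) : ∃ z : ℤ, coeff b (P.root i) k = z := by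
  rcases b.root_mem_or_neg_mem i with h | h
  · obtain ⟨n, hn⟩ := (mem_closure_iff b).1 h k
    exact ⟨n, by rw [hn]; simp⟩
  · obtain ⟨n, hn⟩ := (mem_closure_iff b).1 h k
    refine ⟨-n, ?_⟩
    rw [coeff_neg] at hn
    push_cast
    linarith

theorem coeff_root_nonneg_or_nonpos (i : ι) :
    (∀ k, 0 ≤ coeff b (P.root i) k) ∨ ∀ k, coeff b (P.root i) k ≤ 0 := by
  rcases b.root_mem_or_neg_mem i with h | h
  · left
    intro k
    obtain ⟨n, hn⟩ := (mem_closure_iff b).1 h k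
    rw [hn]
    positivity
  · right
    intro k
    obtain ⟨n, hn⟩ := (mem_closure_iff b).1 h k
    rw [coeff_neg] at hn
    have : (0 : ℝ) ≤ n := by positivity
    linarith

/-- A root with one positive coefficient is positive. -/
theorem coeff_root_nonneg {i : ι} {k₀ : b.support} (h : 0 < coeff b (P.root i) k₀)
    (k : b.support) : 0 ≤ coeff b (P.root i) k := by
  rcases coeff_root_nonneg_or_nonpos b i with h' | h'
  · exact h' k
  · exact absurd (h' k₀) (not_le.2 h)

theorem rootLE_iff {i j : ι} : RootLE b (P.root i) (P.root j) ↔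
    ∀ k, coeff b (P.root i) k ≤ coeff b (P.root j) k := by
  rw [RootLE, mem_closure_iff]
  refine forall_congr' fun k => ?_
  rw [coeff_sub]
  constructor
  · rintro ⟨n, hn⟩
    have : (0 : ℝ) ≤ n := by positivity
    linarith
  · intro h
    obtain ⟨y, hy⟩ := coeff_root_int b i k
    obtain ⟨z, hz⟩ := coeff_root_int b j k
    rw [hy, hz] at h ⊢
    have h' : y ≤ z := by exact_mod_cast h
    refine ⟨(z - y).toNat, ?_⟩
    have : (((z - y).toNat : ℤ) : ℝ) = ((z - y : ℤ) : ℝ) := by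
      rw [Int.toNat_of_nonneg (by omega)]
    push_cast at this
    exact this.symm

theorem rootLE_antisymm {i j : ι} (h : RootLE b (P.root i) (P.root j))
    (h' : RootLE b (P.root j) (P.root i)) : i = j :=
  P.root.injective <| coeff_ext b fun k =>
    le_antisymm ((rootLE_iff b).1 h k) ((rootLE_iff b).1 h' k)

theorem coeff_reflectionPerm_self (i : ι) (k : b.support) :
    coeff b (P.root (P.reflectionPerm k i)) k = coeff b (P.root i) k - P.pairing i k := by
  classical
  rw [root_reflectionPerm_eq, coeff_sub, coeff_smul, coeff_simple b k k]
  simp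

theorem coeff_reflectionPerm_of_ne (i : ι) {k m : b.support} (h : k ≠ m) :
    coeff b (P.root (P.reflectionPerm k i)) m = coeff b (P.root i) m := by
  classical
  rw [root_reflectionPerm_eq, coeff_sub, coeff_smul, coeff_simple b k m]
  simp [h]

theorem ht_reflectionPerm (i : ι) (k : b.support) :
    ht b (P.root (P.reflectionPerm k i)) = ht b (P.root i) - P.pairing i k := by
  classical
  simp only [ht]
  rw [← Finset.add_sum_erase _ _ (Finset.mem_univ k),
    ← Finset.add_sum_erase _ (fun m => coeff b (P.root i) m) (Finset.mem_univ k),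
    coeff_reflectionPerm_self]
  rw [Finset.sum_congr rfl fun m hm =>
    coeff_reflectionPerm_of_ne b i (Finset.ne_of_mem_erase hm).symm]
  ring

theorem ht_lt_of_rootLE {i j : ι} (h : RootLE b (P.root i) (P.root j)) (hne : i ≠ j) :
    ht b (P.root i) < ht b (P.root j) := by
  rw [rootLE_iff] at h
  refine Finset.sum_lt_sum (fun k _ => h k) ?_
  by_contra! hc
  exact hne (P.root.injective (coeff_ext b fun k => le_antisymm (h k) (hc k (Finset.mem_univ k))))

theorem pairing_simple_nonpos [P.IsCrystallographic] {i j : b.support} (h : i ≠ j) :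
    P.pairing i j ≤ 0 := by
  have := b.pairingIn_le_zero_of_ne (fun e => h (Subtype.ext e)) i.2 j.2
  rw [← P.algebraMap_pairingIn ℤ]
  simpa using this

theorem dynkinGraph_adj {i j : b.support} :
    (dynkinGraph b).Adj i j ↔ i ≠ j ∧ P.pairing i j ≠ 0 := by
  have h : P.pairing i j = 0 ↔ P.pairing j i = 0 := pairing_eq_zero_comm
  rw [dynkinGraph, SimpleGraph.fromRel_adj]
  tauto

theorem supp_nonempty (i : ι) : (supp b (P.root i)).Nonempty := by
  by_contra! h
  refine P.ne_zero i (coeff_ext b fun k => ?_)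
  have : k ∉ supp b (P.root i) := by rw [h]; exact Set.notMem_empty k
  simpa [mem_supp] using this

/-- A positive root has a positive pairing with some simple root in its support. -/
theorem exists_pairing_pos {i : ι} (h : ∀ k, 0 ≤ coeff b (P.root i) k) :
    ∃ k ∈ supp b (P.root i), 0 < P.pairing i k := by
  by_contra! hc
  have h1 := rootForm_root_self_pos (P := P) i
  rw [rootForm_eq_sum b] at h1
  refine absurd h1 (not_lt.2 (Finset.sum_nonpos fun k _ => ?_))
  by_cases hk : k ∈ supp b (P.root i)
  · refine mul_nonpos_of_nonneg_of_nonpos (h k) ?_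
    by_contra! h2
    exact absurd (pairing_pos_iff.2 h2) (not_lt.2 (hc k hk))
  · simp only [mem_supp, not_not] at hk
    simp [hk]

end Coefficients

/-! ### Connectedness of supports and of the Dynkin diagram -/

section Connected

variable {ι M N : Type*} [Fintype ι] [AddCommGroup M] [Module ℝ M] [AddCommGroup N] [Module ℝ N]
variable {P : RootPairing ι ℝ M N} [P.IsRootSystem] (b : P.Base)

/-- A positive root that splits along a cut of its support would, after reflections lowering its
height, have only one simple root `k` on one side of the cut, and the coefficient `c` of `k` would
satisfy both `⟨β, k⟩ = 2c` and `⟨β, k⟩ = c`. -/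
theorem not_exists_cut (A : Set b.support) :
    ¬ ∃ i : ι, (∀ k, 0 ≤ coeff b (P.root i) k) ∧ (∃ a ∈ supp b (P.root i), a ∈ A) ∧
      (∃ c ∈ supp b (P.root i), c ∉ A) ∧
      ∀ a ∈ supp b (P.root i), a ∈ A → ∀ c ∈ supp b (P.root i), c ∉ A → P.pairing a c = 0 := by
  classical
  intro hex
  -- a counterexample of minimal height, for either side of the cut
  let s : Set ι := {i | ∃ A : Set b.support, (∀ k, 0 ≤ coeff b (P.root i) k) ∧
      (∃ a ∈ supp b (P.root i), a ∈ A) ∧ (∃ c ∈ supp b (P.root i), c ∉ A) ∧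
      ∀ a ∈ supp b (P.root i), a ∈ A → ∀ c ∈ supp b (P.root i), c ∉ A → P.pairing a c = 0}
  obtain ⟨i, hi, hmin⟩ := Set.exists_min_image s (fun i => ht b (P.root i)) s.toFinite
    (hex.imp fun i hi => ⟨A, hi⟩)
  clear hex A
  obtain ⟨A, hpos, hA, hA', hcut⟩ := hi
  obtain ⟨k, hk, hpk⟩ := exists_pairing_pos b hpos
  wlog hkA : k ∈ A generalizing A
  · refine this Aᶜ (by simpa using hA') (by simpa using hA) ?_ hkA
    intro a ha haA c hc hcA
    rw [pairing_eq_zero_comm]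
    exact hcut c hc (by simpa using hcA) a ha haA
  obtain ⟨c, hc, hcA⟩ := hA'
  have hkc : k ≠ c := fun e => hcA (e ▸ hkA)
  have hsub : ∀ m ∈ supp b (P.root (P.reflectionPerm k i)), m ∈ supp b (P.root i) := by
    intro m hm
    by_cases e : k = m
    · exact e ▸ hk
    · rwa [mem_supp, coeff_reflectionPerm_of_ne b i e] at hm
  have hc' : c ∈ supp b (P.root (P.reflectionPerm k i)) := by
    rwa [mem_supp, coeff_reflectionPerm_of_ne b i hkc]
  have hpos' : ∀ m, 0 ≤ coeff b (P.root (P.reflectionPerm k i)) m := by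
    refine coeff_root_nonneg b (k₀ := c) ?_
    rw [coeff_reflectionPerm_of_ne b i hkc]
    exact lt_of_le_of_ne (hpos c) (Ne.symm hc)
  -- by minimality the reflected root has no support left in `A`
  have hout : ∀ m ∈ supp b (P.root (P.reflectionPerm k i)), m ∉ A := by
    intro m hm hmA
    have := hmin (P.reflectionPerm k i) ⟨A, hpos', ⟨m, hm, hmA⟩, ⟨c, hc', hcA⟩,
      fun a ha haA d hd hdA => hcut a (hsub a ha) haA d (hsub d hd) hdA⟩
    rw [ht_reflectionPerm] at this
    linarith
  have hk0 : coeff b (P.root i) k - P.pairing i k = 0 := by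
    rw [← coeff_reflectionPerm_self]
    by_contra h
    exact hout k h hkA
  have h2 : P.pairing i k = coeff b (P.root i) k * 2 := by
    rw [pairing_eq_sum b, Finset.sum_eq_single k]
    · rw [P.pairing_same]
    · intro m _ hmk
      by_cases hm : m ∈ supp b (P.root i)
      · have hmA : m ∉ A := by
          refine hout m ?_
          rwa [mem_supp, coeff_reflectionPerm_of_ne b i hmk.symm]
        rw [pairing_eq_zero_comm.1 (hcut k hk hkA m hm hmA), mul_zero]
      · simp only [mem_supp, not_not] at hm
        rw [hm, zero_mul]
    · simp
  linarith

theorem supp_connected {i : ι} (h : ∀ k, 0 ≤ coeff b (P.root i) k) :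
    ((dynkinGraph b).induce (supp b (P.root i))).Connected := by
  refine induce_connected_iff.2 ⟨supp_nonempty b i, fun A hA ⟨a, ha⟩ hcut => ?_⟩
  by_contra hne
  obtain ⟨c, hc, hcA⟩ := Set.exists_of_ssubset (hA.ssubset_of_ne hne)
  refine not_exists_cut b A ⟨i, h, ⟨a, hA ha, ha⟩, ⟨c, hc, hcA⟩, fun a _ ha c hc hcA => ?_⟩
  have := hcut a ha c hc hcA
  rw [dynkinGraph_adj, not_and, not_not] at this
  exact this fun e => hcA (e ▸ ha)

/-- The Dynkin diagram of an irreducible root system is connected: the span of a union of components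
is invariant under the Weyl group. -/
theorem univ_connected [P.IsCrystallographic] [P.IsReduced] [P.IsIrreducible] :
    ((dynkinGraph b).induce Set.univ).Connected := by
  classical
  have : Nontrivial M := RootPairing.IsIrreducible.nontrivial (P := P)
  have hne : (Set.univ : Set b.support).Nonempty := by
    by_contra! h
    obtain ⟨x, hx⟩ := exists_ne (0 : M)
    exact hx (coeff_ext b fun k => absurd (Set.mem_univ k) (h ▸ Set.notMem_empty k))
  refine induce_connected_iff.2 ⟨hne, fun A _ ⟨a, ha⟩ hcut => ?_⟩
  let q : Submodule ℝ M := Submodule.span ℝ ((fun k : b.support => P.root k) '' A)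
  have hq : ∀ i ∈ b.support, q ∈ Module.End.invtSubmodule (P.reflection i : M →ₗ[ℝ] M) := by
    intro i hi
    by_cases hiA : (⟨i, hi⟩ : b.support) ∈ A
    · exact Submodule.mem_invtSubmodule_reflection_of_mem _ _
        (Submodule.subset_span ⟨_, hiA, rfl⟩)
    · refine (Module.End.mem_invtSubmodule _).2 (Submodule.span_le.2 ?_)
      rintro _ ⟨k, hk, rfl⟩
      have h0 := hcut k hk ⟨i, hi⟩ trivial hiA
      rw [dynkinGraph_adj, not_and, not_not] at h0
      have h1 : P.pairing k i = 0 := h0 fun e => hiA (e ▸ hk)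
      simp only [Submodule.comap_coe, Set.mem_preimage, LinearEquiv.coe_coe, SetLike.mem_coe,
        P.reflection_apply_root, h1, zero_smul, sub_zero]
      exact Submodule.subset_span ⟨k, hk, rfl⟩
  have hbot : q ≠ ⊥ := fun h => P.ne_zero a <| (Submodule.mem_bot ℝ).1 <|
    h ▸ Submodule.subset_span ⟨a, ha, rfl⟩
  have htop := RootPairing.IsIrreducible.eq_top_of_invtSubmodule_reflection (P := P) q
    ((b.forall_mem_support_invtSubmodule_iff q).1 hq) hbot
  refine Set.eq_univ_of_forall fun c => ?_
  by_contra hc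
  have hle : q ≤ LinearMap.ker (b.toWeightBasis.coord c) := by
    refine Submodule.span_le.2 ?_
    rintro _ ⟨k, hk, rfl⟩
    have : coeff b (P.root k) c = 0 := by
      rw [coeff_simple, if_neg]
      rintro rfl
      exact hc hk
    exact this
  have h1 : coeff b (P.root c) c = 0 := by
    have : P.root c ∈ q := htop ▸ Submodule.mem_top
    exact hle this
  rw [coeff_simple] at h1
  simp at h1

end Connected

/-! ### Dominant and largest short roots -/

section Dominant

variable {ι M N : Type*} [Fintype ι] [AddCommGroup M] [Module ℝ M] [AddCommGroup N] [Module ℝ N]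
variable {P : RootPairing ι ℝ M N} [P.IsRootSystem] [P.IsCrystallographic] (b : P.Base)
variable {S : Set b.support}

theorem coeff_nonneg_of_dominant {β : ι} (hsupp : supp b (P.root β) ⊆ S)
    (hdom : ∀ α ∈ S, 0 ≤ P.pairing β α) (k : b.support) : 0 ≤ coeff b (P.root β) k := by
  rcases coeff_root_nonneg_or_nonpos b β with h | h
  · exact h k
  · exfalso
    have h1 := rootForm_root_self_pos (P := P) β
    rw [rootForm_eq_sum b] at h1
    refine absurd h1 (not_lt.2 (Finset.sum_nonpos fun k _ => ?_))
    by_cases hk : k ∈ supp b (P.root β)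
    · exact mul_nonpos_of_nonpos_of_nonneg (h k) (pairing_nonneg_iff.1 (hdom k (hsupp hk)))
    · simp only [mem_supp, not_not] at hk
      simp [hk]

/-- A root that is dominant on a connected set of simple roots has full support there. -/
theorem supp_eq_of_dominant (hS : ((dynkinGraph b).induce S).Connected) {β : ι}
    (hsupp : supp b (P.root β) ⊆ S) (hdom : ∀ α ∈ S, 0 ≤ P.pairing β α) :
    supp b (P.root β) = S := by
  have hpos := coeff_nonneg_of_dominant b hsupp hdom
  refine (induce_connected_iff.1 hS).2 _ hsupp (supp_nonempty b β) fun a ha c hcS hc => ?_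
  rw [dynkinGraph_adj, not_and, not_not]
  intro _
  have hc0 : coeff b (P.root β) c = 0 := not_not.1 hc
  have hle : ∀ k ∈ Finset.univ, coeff b (P.root β) k * P.pairing k c ≤ 0 := by
    intro k _
    by_cases e : k = c
    · rw [e, hc0, zero_mul]
    · exact mul_nonpos_of_nonneg_of_nonpos (hpos k) (pairing_simple_nonpos b e)
  have h0 : ∑ k, coeff b (P.root β) k * P.pairing k c = 0 := by
    refine le_antisymm (Finset.sum_nonpos hle) ?_
    rw [← pairing_eq_sum]
    exact hdom c hcS
  have := (Finset.sum_eq_zero_iff_of_nonpos hle).1 h0 a (Finset.mem_univ a)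
  exact (mul_eq_zero.1 this).resolve_left ha

/-- The form is positive on two roots that are both dominant on a connected set. -/
theorem rootForm_pos_of_dominant (hS : ((dynkinGraph b).induce S).Connected) {β γ : ι}
    (hβ : supp b (P.root β) ⊆ S) (hβd : ∀ α ∈ S, 0 ≤ P.pairing β α)
    (hγ : supp b (P.root γ) ⊆ S) (hγd : ∀ α ∈ S, 0 ≤ P.pairing γ α) :
    0 < P.RootForm (P.root β) (P.root γ) := by
  have hpos := coeff_nonneg_of_dominant b hγ hγd
  obtain ⟨k, hk, hkp⟩ := exists_pairing_pos b (coeff_nonneg_of_dominant b hβ hβd)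
  rw [rootForm_eq_sum b]
  refine Finset.sum_pos' (fun m _ => ?_) ⟨k, Finset.mem_univ k, ?_⟩
  · by_cases hm : m ∈ supp b (P.root γ)
    · exact mul_nonneg (hpos m) (pairing_nonneg_iff.1 (hβd m (hγ hm)))
    · simp only [mem_supp, not_not] at hm
      simp [hm]
  · have hkγ : k ∈ supp b (P.root γ) := by
      rw [supp_eq_of_dominant b hS hγ hγd]
      exact hβ hk
    exact mul_pos (lt_of_le_of_ne (hpos k) (Ne.symm hkγ)) (pairing_pos_iff.1 hkp)

/-- A connected set of simple roots supports at most one dominant short root. Two of them would form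
an acute angle, so `±(β - γ)` would be roots, and the positive one of these would have a negative
product with `γ` or `β`, against dominance. -/
theorem IsShort.eq_of_dominant (hS : ((dynkinGraph b).induce S).Connected) {β γ : ι}
    (hβs : IsShort P β) (hβ : supp b (P.root β) ⊆ S) (hβd : ∀ α ∈ S, 0 ≤ P.pairing β α)
    (hγs : IsShort P γ) (hγ : supp b (P.root γ) ⊆ S) (hγd : ∀ α ∈ S, 0 ≤ P.pairing γ α) :
    β = γ := by
  by_contra hne
  have hform := rootForm_pos_of_dominant b hS hβ hβd hγ hγd
  -- the difference `δ = β - γ` is a root, so one of `±δ` is positive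
  let δ := P.reflectionPerm γ β
  have hδ : P.root δ = P.root β - P.root γ := by
    rw [root_reflectionPerm_eq, hβs.pairing_eq_one hγs hne hform, one_smul]
  have hsum (x : M) : P.RootForm x (P.root δ) =
      P.RootForm x (P.root β) - P.RootForm x (P.root γ) := by
    rw [hδ, map_sub]
  have hδsupp : ∀ k ∉ S, coeff b (P.root δ) k = 0 := by
    intro k hk
    have h1 : coeff b (P.root β) k = 0 := by
      by_contra h
      exact hk (hβ h)
    have h2 : coeff b (P.root γ) k = 0 := by
      by_contra h
      exact hk (hγ h)
    rw [hδ, coeff_sub, h1, h2, sub_zero]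
  have hlt : P.RootForm (P.root β) (P.root γ) < P.RootForm (P.root γ) (P.root γ) := by
    by_contra! h
    exact hne (hβs.eq_of_rootForm_le hγs h)
  have hlen := hβs.rootForm_eq hγs
  rcases coeff_root_nonneg_or_nonpos b δ with h | h
  · have h1 : 0 ≤ P.RootForm (P.root γ) (P.root δ) := by
      rw [rootForm_eq_sum b]
      refine Finset.sum_nonneg fun k _ => ?_
      by_cases hk : k ∈ S
      · exact mul_nonneg (h k) (pairing_nonneg_iff.1 (hγd k hk))
      · simp [hδsupp k hk]
    rw [hsum, rootForm_comm] at h1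
    linarith
  · have h1 : P.RootForm (P.root β) (P.root δ) ≤ 0 := by
      rw [rootForm_eq_sum b]
      refine Finset.sum_nonpos fun k _ => ?_
      by_cases hk : k ∈ S
      · exact mul_nonpos_of_nonpos_of_nonneg (h k) (pairing_nonneg_iff.1 (hβd k hk))
      · simp [hδsupp k hk]
    rw [hsum] at h1
    linarith

theorem supp_reflectionPerm_subset {i : ι} (hi : supp b (P.root i) ⊆ S) {k : b.support}
    (hk : k ∈ S) : supp b (P.root (P.reflectionPerm k i)) ⊆ S := by
  intro m hm
  by_cases e : k = m
  · exact e ▸ hk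
  · rw [mem_supp, coeff_reflectionPerm_of_ne b i e] at hm
    exact hi hm

theorem IsLargestShortRoot.dominant {β : ι} (h : IsLargestShortRoot b S β) {α : b.support}
    (hα : α ∈ S) : 0 ≤ P.pairing β α := by
  have h1 := (rootLE_iff b).1 (h.2 _ (h.1.1.reflectionPerm α)
    (supp_reflectionPerm_subset b h.1.2 hα)) α
  rw [coeff_reflectionPerm_self] at h1
  linarith

theorem IsLargestShortRoot.eq {β γ : ι} (h : IsLargestShortRoot b S β)
    (h' : IsLargestShortRoot b S γ) : β = γ :=
  rootLE_antisymm b (h'.2 _ h.1.1 h.1.2) (h.2 _ h'.1.1 h'.1.2)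

theorem IsLargestShortRoot.supp_eq (hS : ((dynkinGraph b).induce S).Connected) {β : ι}
    (h : IsLargestShortRoot b S β) : supp b (P.root β) = S :=
  supp_eq_of_dominant b hS h.1.2 fun _ hα => h.dominant b hα

theorem IsLargestShortRoot.coeff_pos (hS : ((dynkinGraph b).induce S).Connected) {β : ι}
    (h : IsLargestShortRoot b S β) {k : b.support} (hk : k ∈ S) : 0 < coeff b (P.root β) k := by
  refine lt_of_le_of_ne
    (coeff_nonneg_of_dominant b h.1.2 (fun _ hα => h.dominant b hα) k) (Ne.symm ?_)
  rwa [← h.supp_eq b hS] at hk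

/-- Every short root supported in `S` lies below a short root that is dominant on `S`. -/
theorem exists_dominant_ge {γ : ι} (hγ : IsShort P γ) (hsupp : supp b (P.root γ) ⊆ S) :
    ∃ β, IsShort P β ∧ supp b (P.root β) ⊆ S ∧ (∀ α ∈ S, 0 ≤ P.pairing β α) ∧
      RootLE b (P.root γ) (P.root β) := by
  let s : Set ι := {β | IsShort P β ∧ supp b (P.root β) ⊆ S ∧ RootLE b (P.root γ) (P.root β)}
  obtain ⟨β, ⟨h1, h2, h3⟩, hmax⟩ := Set.exists_max_image s (fun i => ht b (P.root i)) s.toFinite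
    ⟨γ, hγ, hsupp, (rootLE_iff b).2 fun _ => le_rfl⟩
  refine ⟨β, h1, h2, fun α hα => ?_, h3⟩
  by_contra! hneg
  have := hmax (P.reflectionPerm α β) ⟨h1.reflectionPerm _, supp_reflectionPerm_subset b h2 hα,
    (rootLE_iff b).2 fun m => ?_⟩
  · rw [ht_reflectionPerm] at this
    linarith
  · have h4 := (rootLE_iff b).1 h3 m
    by_cases e : α = m
    · subst e
      rw [coeff_reflectionPerm_self]
      linarith
    · rwa [coeff_reflectionPerm_of_ne b β e]

theorem exists_isLargestShortRoot (hS : ((dynkinGraph b).induce S).Connected) {γ : ι}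
    (hγ : IsShort P γ) (hsupp : supp b (P.root γ) ⊆ S) : ∃ β, IsLargestShortRoot b S β := by
  obtain ⟨β, h1, h2, h3, -⟩ := exists_dominant_ge b hγ hsupp
  refine ⟨β, ⟨h1, h2⟩, fun γ' hγ' hsupp' => ?_⟩
  obtain ⟨β', h1', h2', h3', hle⟩ := exists_dominant_ge b hγ' hsupp'
  rwa [IsShort.eq_of_dominant b hS h1 h2 h3 h1' h2' h3']

end Dominant

/-! ### Nesting of cascade sets -/

section Cascade

variable {ι M N : Type*} [Fintype ι] [AddCommGroup M] [Module ℝ M] [AddCommGroup N] [Module ℝ N]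
variable {P : RootPairing ι ℝ M N} [P.IsRootSystem] [P.IsCrystallographic] [P.IsReduced]
  [P.IsIrreducible] (b : P.Base)

theorem IsCascadeSet.connected {S : Set b.support} (h : IsCascadeSet b S) :
    ((dynkinGraph b).induce S).Connected := by
  cases h with
  | top => exact univ_connected b
  | step S T β hS hβ hT => exact hT.2.1

theorem mem_cascade_iff {γ : ι} : γ ∈ cascade b ↔
    IsCascadeSet b (supp b (P.root γ)) ∧ IsLargestShortRoot b (supp b (P.root γ)) γ := by
  constructor
  · rintro ⟨S, hS, hγ⟩
    rw [hγ.supp_eq b hS.connected]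
    exact ⟨hS, hγ⟩
  · rintro ⟨hS, hγ⟩
    exact ⟨_, hS, hγ⟩

/-- `S` is contained in `T` and orthogonal to the largest short root of `T`, as all cascade sets
obtained from `T` are. -/
def Below (S T : Set b.support) : Prop :=
  ∃ β, IsLargestShortRoot b T β ∧ S ⊆ {α | α ∈ T ∧ P.pairing β α = 0}

variable {b} in
theorem Below.subset {S T : Set b.support} (h : Below b S T) : S ⊆ T := by
  obtain ⟨β, -, h⟩ := h
  exact fun _ hα => (h hα).1

variable {b} in
theorem Below.mono {R S T : Set b.support} (h : Below b S T) (hR : R ⊆ S) : Below b R T := by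
  obtain ⟨β, hβ, h⟩ := h
  exact ⟨β, hβ, hR.trans h⟩

theorem not_below_self (S : Set b.support) : ¬ Below b S S := by
  rintro ⟨β, hβ, h⟩
  have h1 := rootForm_root_self_pos (P := P) β
  rw [rootForm_eq_sum b, Finset.sum_eq_zero] at h1
  · exact lt_irrefl _ h1
  · intro k _
    by_cases hk : k ∈ supp b (P.root β)
    · rw [pairing_eq_zero_iff_rootForm.1 (h (hβ.1.2 hk)).2, mul_zero]
    · simp only [mem_supp, not_not] at hk
      rw [hk, zero_mul]

/-- Cascade sets that share a simple root are nested. -/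
theorem IsCascadeSet.nested {S T : Set b.support} (hS : IsCascadeSet b S) (hT : IsCascadeSet b T)
    {i₀ : b.support} (hiS : i₀ ∈ S) (hiT : i₀ ∈ T) : S = T ∨ Below b S T ∨ Below b T S := by
  induction hS generalizing T with
  | top =>
    clear hiS
    induction hT with
    | top => exact Or.inl rfl
    | step S T β hS hβ hT ih =>
      right; right
      have hTS : Below b T S := ⟨β, hβ, hT.1⟩
      rcases ih (hTS.subset hiT) with h | h | h
      · rwa [h]
      · rwa [Set.univ_subset_iff.1 h.subset] at hTS
      · exact h.mono hTS.subset
  | step S₁ S β hS₁ hβ hS ih =>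
    have hSS₁ : Below b S S₁ := ⟨β, hβ, hS.1⟩
    have hi₁ : i₀ ∈ S₁ := hSS₁.subset hiS
    rcases ih hT hi₁ hiT with h | h | h
    · exact Or.inr (Or.inl (h ▸ hSS₁))
    · exact Or.inr (Or.inl (h.mono hSS₁.subset))
    obtain ⟨β', hβ', h⟩ := h
    obtain rfl := hβ.eq b hβ'
    have hTS : T ⊆ S := hS.subset_of_connected hT.connected h ⟨i₀, hiS, hiT⟩
    -- what is left is the case `T ⊆ S`, by induction on `T`
    clear h hβ'
    have hSc := hS.2.1
    induction hT with
    | top => exact Or.inl (Set.univ_subset_iff.1 hTS)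
    | step T₁ T β' hT₁ hβ' hT ihT =>
      have hTT₁ : Below b T T₁ := ⟨β', hβ', hT.1⟩
      have hi₂ : i₀ ∈ T₁ := hTT₁.subset hiT
      have hcmp : S = T₁ ∨ Below b S T₁ ∨ Below b T₁ S := by
        rcases ih hT₁ hi₁ hi₂ with h | h | h
        · exact Or.inr (Or.inl (h ▸ hSS₁))
        · exact Or.inr (Or.inl (h.mono hSS₁.subset))
        · obtain ⟨β₂, hβ₂, h⟩ := h
          obtain rfl := hβ.eq b hβ₂
          exact ihT hi₂ (hS.subset_of_connected hT₁.connected h ⟨i₀, hiS, hi₂⟩)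
      rcases hcmp with h | h | h
      · exact Or.inr (Or.inr (h ▸ hTT₁))
      · left
        obtain ⟨β₂, hβ₂, h⟩ := h
        obtain rfl := hβ'.eq b hβ₂
        exact (hT.subset_of_connected hSc h ⟨i₀, hiT, hiS⟩).antisymm hTS
      · exact Or.inr (Or.inr (h.mono hTT₁.subset))

theorem rootLE_of_below {γ y : ι} (hγ : γ ∈ cascade b) (hy : y ∈ cascade b)
    (h : Below b (supp b (P.root γ)) (supp b (P.root y))) :
    RootLE b (P.root γ) (P.root y) ∧ γ ≠ y ∧ P.pairing γ y = 0 := by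
  have hy' := ((mem_cascade_iff b).1 hy).2
  refine ⟨hy'.2 γ ((mem_cascade_iff b).1 hγ).2.1.1 h.subset, ?_, ?_⟩
  · rintro rfl
    exact not_below_self b _ h
  · obtain ⟨β, hβ, h⟩ := h
    obtain rfl := hy'.eq b hβ
    rw [pairing_eq_zero_comm, pairing_eq_zero_iff_rootForm, rootForm_eq_sum b]
    refine Finset.sum_eq_zero fun k _ => ?_
    by_cases hk : k ∈ supp b (P.root γ)
    · rw [pairing_eq_zero_iff_rootForm.1 (h hk).2, mul_zero]
    · simp only [mem_supp, not_not] at hk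
      rw [hk, zero_mul]

end Cascade

/-! ### The set `Ψ` and its cascade elements -/

section PsiSet

variable {ι M N : Type*} [Fintype ι] [AddCommGroup M] [Module ℝ M] [AddCommGroup N] [Module ℝ N]
variable {P : RootPairing ι ℝ M N} [P.IsRootSystem] [P.IsCrystallographic] [P.IsReduced]
  [P.IsIrreducible] (b : P.Base) {β₁ : ι} {I : Set b.support}

theorem mem_Psi_iff {β : ι} : β ∈ Psi b β₁ I ↔
    IsShort P β ∧ ∀ k ∉ I, coeff b (P.root β) k = coeff b (P.root β₁) k := by
  refine and_congr_right fun _ => ⟨fun h k hk => ?_, fun h k hk => ?_⟩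
  · by_contra hne
    refine hk (h ?_)
    rw [mem_supp, coeff_sub, sub_ne_zero]
    exact Ne.symm hne
  · by_contra hkI
    rw [mem_supp, coeff_sub, h k hkI, sub_self] at hk
    exact hk rfl

variable (hβ₁ : IsLargestShortRoot b Set.univ β₁)

include hβ₁

theorem largest_mem_Psi : β₁ ∈ Psi b β₁ I := (mem_Psi_iff b).2 ⟨hβ₁.1.1, fun _ _ => rfl⟩

theorem largest_mem_cascade : β₁ ∈ cascade b := ⟨_, IsCascadeSet.top, hβ₁⟩

theorem coeff_pos_of_mem_Psi {β : ι} (hβ : β ∈ Psi b β₁ I) {k : b.support} (hk : k ∉ I) :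
    0 < coeff b (P.root β) k := by
  rw [((mem_Psi_iff b).1 hβ).2 k hk]
  exact hβ₁.coeff_pos b (univ_connected b) trivial

theorem mem_supp_of_mem_Psi {β : ι} (hβ : β ∈ Psi b β₁ I) {k : b.support} (hk : k ∉ I) :
    k ∈ supp b (P.root β) :=
  (coeff_pos_of_mem_Psi b hβ₁ hβ hk).ne'

theorem supp_connected_of_mem_Psi {β : ι} (hβ : β ∈ Psi b β₁ I) (hI : I ≠ Set.univ) :
    ((dynkinGraph b).induce (supp b (P.root β))).Connected := by
  obtain ⟨k, hk⟩ := (Set.ne_univ_iff_exists_notMem I).1 hI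
  exact supp_connected b (coeff_root_nonneg b (coeff_pos_of_mem_Psi b hβ₁ hβ hk))

theorem mem_Psi_of_rootLE {β γ : ι} (hγ : γ ∈ Psi b β₁ I) (hβ : IsShort P β)
    (h : RootLE b (P.root γ) (P.root β)) : β ∈ Psi b β₁ I := by
  refine (mem_Psi_iff b).2 ⟨hβ, fun k hk => le_antisymm ?_ ?_⟩
  · exact (rootLE_iff b).1 (hβ₁.2 β hβ (Set.subset_univ _)) k
  · rw [← ((mem_Psi_iff b).1 hγ).2 k hk]
    exact (rootLE_iff b).1 h k

/-- The cascade elements in `Ψ` form a chain: comparability of roots amounts to nested supports. -/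
theorem cascade_trichotomy (hI : I ≠ Set.univ) {γ y : ι} (hγ : γ ∈ cascade b)
    (hγΨ : γ ∈ Psi b β₁ I) (hy : y ∈ cascade b) (hyΨ : y ∈ Psi b β₁ I) :
    γ = y ∨ Below b (supp b (P.root γ)) (supp b (P.root y)) ∨
      Below b (supp b (P.root y)) (supp b (P.root γ)) := by
  obtain ⟨k, hk⟩ := (Set.ne_univ_iff_exists_notMem I).1 hI
  have hγ' := (mem_cascade_iff b).1 hγ
  have hy' := (mem_cascade_iff b).1 hy
  refine (hγ'.1.nested b hy'.1 (mem_supp_of_mem_Psi b hβ₁ hγΨ hk)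
    (mem_supp_of_mem_Psi b hβ₁ hyΨ hk)).imp_left fun h => ?_
  exact hγ'.2.eq b (h ▸ hy'.2)

theorem below_iff_rootLE (hI : I ≠ Set.univ) {γ y : ι} (hγ : γ ∈ cascade b)
    (hγΨ : γ ∈ Psi b β₁ I) (hy : y ∈ cascade b) (hyΨ : y ∈ Psi b β₁ I) :
    Below b (supp b (P.root γ)) (supp b (P.root y)) ↔ RootLE b (P.root γ) (P.root y) ∧ γ ≠ y := by
  refine ⟨fun h => ⟨(rootLE_of_below b hγ hy h).1, (rootLE_of_below b hγ hy h).2.1⟩, ?_⟩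
  rintro ⟨hle, hne⟩
  rcases cascade_trichotomy b hβ₁ hI hγ hγΨ hy hyΨ with h | h | h
  · exact absurd h hne
  · exact h
  · exact absurd (rootLE_antisymm b hle (rootLE_of_below b hy hγ h).1) hne

/-- Whether `γ ∈ Ψ` lies in the cascade is decided by the larger cascade elements in `Ψ`: it has
to be orthogonal to all of them. -/
theorem mem_cascade_iff_orthogonal (hI : I ≠ Set.univ) {γ : ι} (hγ : γ ∈ Psi b β₁ I) :
    γ ∈ cascade b ↔ ∀ y ∈ Psi b β₁ I, y ∈ cascade b → RootLE b (P.root γ) (P.root y) → γ ≠ y →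
      P.pairing γ y = 0 := by
  constructor
  · intro hγK y hyΨ hy hle hne
    exact (rootLE_of_below b hγK hy
      ((below_iff_rootLE b hβ₁ hI hγK hγ hy hyΨ).2 ⟨hle, hne⟩)).2.2
  · intro h
    have hconn := supp_connected_of_mem_Psi b hβ₁ hγ hI
    -- a minimal cascade set containing the support of `γ`
    obtain ⟨S, -, hSmin⟩ := (Set.toFinite {S | IsCascadeSet b S ∧
      supp b (P.root γ) ⊆ S}).exists_le_minimal (a := Set.univ)
      ⟨IsCascadeSet.top, Set.subset_univ _⟩
    obtain ⟨⟨hS, hγS⟩, hmin⟩ := hSmin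
    obtain ⟨β, hβ⟩ := exists_isLargestShortRoot b hS.connected hγ.1 hγS
    by_cases e : γ = β
    · exact ⟨S, hS, e ▸ hβ⟩
    exfalso
    have hle := hβ.2 γ hγ.1 hγS
    have h0 := h β (mem_Psi_of_rootLE b hβ₁ hγ hβ.1.1 hle) ⟨S, hS, hβ⟩ hle e
    have hperp : supp b (P.root γ) ⊆ {α | α ∈ S ∧ P.pairing β α = 0} := by
      obtain ⟨k, hk⟩ := (Set.ne_univ_iff_exists_notMem I).1 hI
      have hpos := coeff_root_nonneg b (coeff_pos_of_mem_Psi b hβ₁ hγ hk)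
      rw [pairing_eq_zero_comm, pairing_eq_zero_iff_rootForm, rootForm_eq_sum b,
        Finset.sum_eq_zero_iff_of_nonneg] at h0
      · intro α hα
        exact ⟨hγS hα, pairing_eq_zero_iff_rootForm.2
          ((mul_eq_zero.1 (h0 α (Finset.mem_univ α))).resolve_left hα)⟩
      · intro m _
        by_cases hm : m ∈ supp b (P.root γ)
        · exact mul_nonneg (hpos m) (pairing_nonneg_iff.1 (hβ.dominant b (hγS hm)))
        · simp only [mem_supp, not_not] at hm
          simp [hm]
    obtain ⟨T, hγT, hT⟩ := exists_isComponent hconn hperp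
    have hTS : Below b T S := ⟨β, hβ, hT.1⟩
    have := hmin ⟨IsCascadeSet.step S T β hS hβ hT, hγT⟩ hTS.subset
    exact not_below_self b S (hTS.mono this)

/-- On the chain of cascade elements in `Ψ`, predecessors are immediate predecessors for the
(reversed) root order. -/
theorem isPredecessor_iff (hI : I ≠ Set.univ) {β γ : ι} (hβ : β ∈ cascade b)
    (hβΨ : β ∈ Psi b β₁ I) (hγ : γ ∈ cascade b) (hγΨ : γ ∈ Psi b β₁ I) :
    IsPredecessor b β γ ↔ (RootLE b (P.root γ) (P.root β) ∧ γ ≠ β) ∧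
      ∀ y ∈ Psi b β₁ I, y ∈ cascade b → RootLE b (P.root γ) (P.root y) →
        RootLE b (P.root y) (P.root β) → y = γ ∨ y = β := by
  have hβ' := (mem_cascade_iff b).1 hβ
  have hγ' := (mem_cascade_iff b).1 hγ
  have hset : supp b (P.root β) \ {α | α ∈ supp b (P.root β) ∧ 0 < P.pairing β α} =
      {α | α ∈ supp b (P.root β) ∧ P.pairing β α = 0} := by
    ext α
    simp only [Set.mem_sdiff, Set.mem_ofPred_eq, not_and, not_lt]
    refine and_congr_right fun hα => ⟨fun h => le_antisymm (h hα) (hβ'.2.dominant b hα), ?_⟩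
    intro h _
    exact h.le
  rw [IsPredecessor, hset]
  constructor
  · rintro ⟨-, -, hcomp⟩
    refine ⟨(below_iff_rootLE b hβ₁ hI hγ hγΨ hβ hβΨ).1 ⟨β, hβ'.2, hcomp.1⟩, ?_⟩
    intro y hyΨ hy h1 h2
    by_contra! hne
    obtain ⟨hne1, hne2⟩ := hne
    have hγy := (below_iff_rootLE b hβ₁ hI hγ hγΨ hy hyΨ).2 ⟨h1, hne1.symm⟩
    obtain ⟨β', hβ'', hsub⟩ := (below_iff_rootLE b hβ₁ hI hy hyΨ hβ hβΨ).2 ⟨h2, hne2⟩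
    obtain rfl := hβ'.2.eq b hβ''
    have := hcomp.2.2 _ hγy.subset hsub ((mem_cascade_iff b).1 hy).1.connected
    rw [this] at hγy
    exact not_below_self b _ hγy
  · rintro ⟨hlt, hcov⟩
    refine ⟨hβ, hγ, ?_⟩
    obtain ⟨β', hβ'', hsub⟩ := (below_iff_rootLE b hβ₁ hI hγ hγΨ hβ hβΨ).2 hlt
    obtain rfl := hβ'.2.eq b hβ''
    obtain ⟨T, hγT, hT⟩ := exists_isComponent hγ'.1.connected hsub
    have hTc := IsCascadeSet.step _ T β hβ'.1 hβ'.2 hT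
    obtain ⟨y, hy⟩ := exists_isLargestShortRoot b hTc.connected hγΨ.1 hγT
    have hle := hy.2 γ hγΨ.1 hγT
    have hyK : y ∈ cascade b := ⟨T, hTc, hy⟩
    have hyβ : Below b (supp b (P.root y)) (supp b (P.root β)) := by
      rw [hy.supp_eq b hTc.connected]
      exact ⟨β, hβ'.2, hT.1⟩
    obtain ⟨h1, h2, -⟩ := rootLE_of_below b hyK hβ hyβ
    have e := (hcov y (mem_Psi_of_rootLE b hβ₁ hγΨ hy.1.1 hle) hyK hle h1).resolve_right h2
    rwa [← e, hy.supp_eq b hTc.connected]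

/-- An element of `Ψ` other than `β₁` is not dominant on `I`: otherwise `(β, β₁ - β) ≥ 0`, which is
the equality case of the Cauchy-Schwarz inequality. -/
theorem exists_pairing_neg {β : ι} (hβ : β ∈ Psi b β₁ I) (hne : β ≠ β₁) :
    ∃ i ∈ I, P.pairing β i < 0 := by
  by_contra! h
  refine hne (IsShort.eq_of_rootForm_le hβ.1 hβ₁.1.1 ?_)
  have h1 : 0 ≤ P.RootForm (P.root β) (P.root β₁ - P.root β) := by
    rw [rootForm_eq_sum b]
    refine Finset.sum_nonneg fun k _ => ?_
    by_cases hk : k ∈ I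
    · refine mul_nonneg ?_ (pairing_nonneg_iff.1 (h k hk))
      rw [coeff_sub, sub_nonneg]
      exact (rootLE_iff b).1 (hβ₁.2 β hβ.1 (Set.subset_univ _)) k
    · rw [coeff_sub, ((mem_Psi_iff b).1 hβ).2 k hk, sub_self, zero_mul]
  rw [map_sub, hβ.1.rootForm_eq hβ₁.1.1] at h1
  linarith

omit hβ₁ in
theorem reflectionPerm_mem_Psi {β : ι} (hβ : β ∈ Psi b β₁ I) {i : b.support} (hi : i ∈ I) :
    P.reflectionPerm i β ∈ Psi b β₁ I := by
  refine (mem_Psi_iff b).2 ⟨hβ.1.reflectionPerm i, fun k hk => ?_⟩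
  have hik : i ≠ k := by
    rintro rfl
    exact hk hi
  rw [coeff_reflectionPerm_of_ne b β hik]
  exact ((mem_Psi_iff b).1 hβ).2 k hk

/-- `Ψ` is the orbit of `β₁` under the reflections in `I`. -/
theorem Psi_induction {p : ι → Prop} (h₁ : p β₁)
    (h : ∀ β ∈ Psi b β₁ I, p β → ∀ i ∈ I, p (P.reflectionPerm i β)) {β : ι}
    (hβ : β ∈ Psi b β₁ I) : p β := by
  by_contra hp
  obtain ⟨γ, ⟨hγ, hpγ⟩, hmax⟩ := Set.exists_max_image {β | β ∈ Psi b β₁ I ∧ ¬ p β}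
    (fun i => ht b (P.root i)) (Set.toFinite _) ⟨β, hβ, hp⟩
  obtain ⟨i, hi, hneg⟩ := exists_pairing_neg b hβ₁ hγ fun e => hpγ (e ▸ h₁)
  have hmem := reflectionPerm_mem_Psi b hγ hi
  by_cases hpi : p (P.reflectionPerm i γ)
  · have := h _ hmem hpi i hi
    rw [P.reflectionPerm_self] at this
    exact hpγ this
  · have := hmax _ ⟨hmem, hpi⟩
    rw [ht_reflectionPerm] at this
    linarith

/-- The cascade elements in `Ψ`, listed in decreasing order, form a chain of predecessors. -/
theorem exists_predecessor_chain (hI : I ≠ Set.univ) :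
    ∃ (r : ℕ) (c : Fin (r + 1) → Psi b β₁ I), Function.Injective c ∧
      Set.range c = {β : Psi b β₁ I | (β : ι) ∈ cascade b} ∧ (c 0 : ι) = β₁ ∧
      ∀ j : Fin r, IsPredecessor b (c j.castSucc) (c j.succ) := by
  classical
  let C := {β : Psi b β₁ I // (β : ι) ∈ cascade b}
  have tri : ∀ x y : C, x = y ∨ (RootLE b (P.root x.1) (P.root y.1) ∧ x.1.1 ≠ y.1.1) ∨
      (RootLE b (P.root y.1) (P.root x.1) ∧ y.1.1 ≠ x.1.1) := by
    intro x y
    rcases cascade_trichotomy b hβ₁ hI x.2 x.1.2 y.2 y.1.2 with h | h | h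
    · exact Or.inl (Subtype.ext (Subtype.ext h))
    · exact Or.inr (Or.inl ((below_iff_rootLE b hβ₁ hI x.2 x.1.2 y.2 y.1.2).1 h))
    · exact Or.inr (Or.inr ((below_iff_rootLE b hβ₁ hI y.2 y.1.2 x.2 x.1.2).1 h))
  -- the chain is enumerated by decreasing height
  let h : C → ℝ := fun x => -ht b (P.root x.1)
  have hinj : Function.Injective h := by
    intro x y hxy
    rcases tri x y with e | e | e
    · exact e
    · have := ht_lt_of_rootLE b e.1 e.2
      simp only [h] at hxy
      linarith
    · have := ht_lt_of_rootLE b e.1 e.2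
      simp only [h] at hxy
      linarith
  let : LinearOrder C := LinearOrder.lift' h hinj
  have hle : ∀ x y : C, x ≤ y ↔ RootLE b (P.root y.1) (P.root x.1) := by
    intro x y
    change h x ≤ h y ↔ _
    constructor
    · intro hxy
      rcases tri x y with e | e | e
      · rw [e]
        exact (rootLE_iff b).2 fun _ => le_rfl
      · have := ht_lt_of_rootLE b e.1 e.2
        simp only [h] at hxy
        linarith
      · exact e.1
    · intro hxy
      by_cases e : y.1.1 = x.1.1
      · rw [Subtype.ext (Subtype.ext e)]
      · have := ht_lt_of_rootLE b hxy e
        simp only [h]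
        linarith
  let top : C := ⟨⟨β₁, largest_mem_Psi b hβ₁⟩, largest_mem_cascade b hβ₁⟩
  have : Finite C := inferInstance
  let : Fintype C := Fintype.ofFinite C
  obtain ⟨r, hr⟩ : ∃ r, Fintype.card C = r + 1 :=
    Nat.exists_eq_succ_of_ne_zero (Fintype.card_pos_iff.2 ⟨top⟩).ne'
  let e : Fin (r + 1) ≃o C := Fintype.orderIsoFinOfCardEq C hr
  refine ⟨r, fun j => (e j).1, fun i j hij => e.injective (Subtype.ext hij), ?_, ?_, fun j => ?_⟩
  · ext β
    constructor
    · rintro ⟨j, rfl⟩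
      exact (e j).2
    · intro hβ
      exact ⟨e.symm ⟨β, hβ⟩, by simp⟩
  · have h1 : e 0 ≤ top := by
      rw [← e.apply_symm_apply top]
      exact e.monotone (Fin.zero_le _)
    have h2 : top ≤ e 0 := (hle _ _).2 (hβ₁.2 _ (e 0).1.2.1 (Set.subset_univ _))
    exact congrArg (fun z : C => (z.1 : ι)) (le_antisymm h1 h2)
  · refine (isPredecessor_iff b hβ₁ hI (e _).2 (e _).1.2 (e _).2 (e _).1.2).2 ⟨⟨?_, ?_⟩, ?_⟩
    · exact (hle _ _).1 (e.monotone (Fin.castSucc_lt_succ).le)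
    · intro heq
      have := e.injective (Subtype.ext (Subtype.ext heq))
      exact absurd this (Fin.castSucc_lt_succ).ne'
    · intro y hyΨ hy h1 h2
      let y' : C := ⟨⟨y, hyΨ⟩, hy⟩
      obtain ⟨m, hm⟩ := e.surjective y'
      have h1' : e m ≤ e j.succ := hm ▸ (hle y' _).2 h1
      have h2' : e j.castSucc ≤ e m := hm ▸ (hle _ y').2 h2
      rw [e.le_iff_le, Fin.le_def] at h1' h2'
      have hy' : y = (e m).1.1 := by rw [hm]
      simp only [Fin.val_succ, Fin.val_castSucc] at h1' h2'
      rcases Nat.lt_or_ge j.1 m.1 with hlt | hge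
      · left
        rw [hy', show m = j.succ from Fin.ext (by simp; omega)]
      · right
        rw [hy', show m = j.castSucc from Fin.ext (by simp; omega)]

end PsiSet

/-! ### Linear extension of a bijection of vertices -/

section LinExt

variable {V₁ V₂ : Type*} {K₁ : Set V₁} {K₂ : Set V₂} (f : K₁ ≃ K₂)

theorem linExt_apply (u : Finsupp.supported ℝ ℝ K₁) (x : K₁) :
    (linExt f u : V₂ →₀ ℝ) (f x) = (u : V₁ →₀ ℝ) x := by
  classical
  simp [linExt, Finsupp.congr]

theorem supported_ext {u v : Finsupp.supported ℝ ℝ K₁}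
    (h : ∀ x : K₁, (u : V₁ →₀ ℝ) x = (v : V₁ →₀ ℝ) x) : u = v := by
  refine Subtype.ext (Finsupp.ext fun x => ?_)
  by_cases hx : x ∈ K₁
  · exact h ⟨x, hx⟩
  · have aux (w : Finsupp.supported ℝ ℝ K₁) : (w : V₁ →₀ ℝ) x = 0 := by
      by_contra hw
      exact hx ((Finsupp.mem_supported ℝ _).1 w.2 (Finsupp.mem_support_iff.2 hw))
    rw [aux, aux]

theorem linExt_symm_linExt (u : Finsupp.supported ℝ ℝ K₁) :
    linExt f.symm (linExt f u) = u := by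
  refine supported_ext fun x => ?_
  have := linExt_apply f.symm (linExt f u) (f x)
  rwa [f.symm_apply_apply, linExt_apply] at this

/-- A vertex in `K`, as an element of `ℝK`. -/
def vertex (x : K₁) : Finsupp.supported ℝ ℝ K₁ :=
  ⟨Finsupp.single (x : V₁) 1, Finsupp.single_mem_supported ℝ _ x.2⟩

theorem linExt_vertex (x : K₁) : linExt f (vertex x) = vertex (f x) := by
  classical
  refine supported_ext fun y => ?_
  obtain ⟨y, rfl⟩ := f.surjective y
  rw [linExt_apply]
  simp [vertex, Finsupp.single_apply, Subtype.ext_iff.symm]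

theorem supported_induction {p : Finsupp.supported ℝ ℝ K₁ → Prop} (hv : ∀ x, p (vertex x))
    (h0 : p 0) (hadd : ∀ u v, p u → p v → p (u + v)) (hsmul : ∀ (c : ℝ) u, p u → p (c • u))
    (u : Finsupp.supported ℝ ℝ K₁) : p u := by
  have hspan : (⊤ : Submodule ℝ (Finsupp.supported ℝ ℝ K₁)) ≤
      Submodule.span ℝ (Set.range vertex) := by
    intro u _
    rw [← Submodule.apply_mem_span_image_iff_mem_span (Submodule.subtype_injective _)]
    have := (Finsupp.supported_eq_span_single ℝ K₁).le u.2
    refine Submodule.span_mono ?_ this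
    rintro _ ⟨x, hx, rfl⟩
    exact ⟨vertex ⟨x, hx⟩, ⟨_, rfl⟩, rfl⟩
  induction hspan (Submodule.mem_top (x := u)) using Submodule.span_induction with
  | mem x hx =>
    obtain ⟨y, rfl⟩ := hx
    exact hv y
  | zero => exact h0
  | add x y _ _ hx hy => exact hadd x y hx hy
  | smul c x _ hx => exact hsmul c x hx

end LinExt

/-! ### The extended space and its projection to `ℝΦ` -/

section AffineSpace

variable {ι M N : Type*} [Fintype ι] [AddCommGroup M] [Module ℝ M] [AddCommGroup N] [Module ℝ N]
variable {P : RootPairing ι ℝ M N} (b : P.Base) (β₁ : ι)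

theorem affProj_single (x : Option b.support) :
    affProj b β₁ (Finsupp.single x 1) = P.root (vertexRoot b β₁ x) := by
  simp [affProj]

theorem root_vertexRoot_none : P.root (vertexRoot b β₁ none) = -P.root β₁ := by
  simp [vertexRoot]

theorem two_mul_normForm (x : M) (j : ι) :
    2 * normForm P β₁ x (P.root j) = P.coroot' j x * normForm P β₁ (P.root j) (P.root j) := by
  have := two_mul_rootForm_root (P := P) x j
  simp only [normForm, LinearMap.smul_apply, smul_eq_mul]
  linear_combination (2 / P.RootForm (P.root β₁) (P.root β₁)) * this

theorem normForm_comm (x y : M) : normForm P β₁ x y = normForm P β₁ y x := by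
  simp only [normForm, LinearMap.smul_apply, rootForm_comm x y]

theorem pairing_eq_zero_iff_normForm {i j : ι} :
    P.pairing i j = 0 ↔ normForm P β₁ (P.root i) (P.root j) = 0 := by
  have := rootForm_root_self_pos (P := P) β₁
  rw [pairing_eq_zero_iff_rootForm, normForm, LinearMap.smul_apply, LinearMap.smul_apply,
    smul_eq_mul, mul_eq_zero_iff_left (by positivity)]

theorem normForm_self : normForm P β₁ (P.root β₁) (P.root β₁) = 2 := by
  have := rootForm_root_self_pos (P := P) β₁
  simp only [normForm, LinearMap.smul_apply, smul_eq_mul]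
  field_simp

variable [P.IsRootSystem]

theorem affProj_affIncl (x : M) : affProj b β₁ (affIncl b x) = x := by
  simp only [affProj, affIncl, LinearMap.comp_apply, Finsupp.lmapDomain_apply,
    LinearEquiv.coe_coe, Finsupp.linearCombination_mapDomain]
  conv_rhs => rw [← b.toWeightBasis.linearCombination_repr x]
  congr 2
  ext k
  simp [vertexRoot]

theorem affProj_delta : affProj b β₁ (delta b β₁) = 0 := by
  rw [delta, map_add, affProj_affIncl, affProj_single, root_vertexRoot_none, neg_add_cancel]

theorem affIncl_apply_some (x : M) (k : b.support) : affIncl b x (some k) = coeff b x k := by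
  simp only [affIncl, LinearMap.comp_apply, Finsupp.lmapDomain_apply, LinearEquiv.coe_coe]
  exact Finsupp.mapDomain_apply (Option.some_injective _) _ k

theorem affIncl_simple (k : b.support) : affIncl b (P.root k) = Finsupp.single (some k) 1 := by
  simp [affIncl]

theorem delta_apply_some (k : b.support) :
    delta b β₁ (some k) = coeff b (P.root β₁) k := by
  simp [delta, affIncl_apply_some]

end AffineSpace

section Vertices

variable {ι M N : Type*} [AddCommGroup M] [Module ℝ M] [AddCommGroup N] [Module ℝ N]
  {P : RootPairing ι ℝ M N} {b : P.Base}

/-- The vertex `α₀` of `I ∪ {α₀}`. -/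
def zeroVertex (I : Set b.support) : extSet I := ⟨none, Set.mem_insert _ _⟩

/-- A simple root in `I` as a vertex of `I ∪ {α₀}`. -/
def simpleVertex {I : Set b.support} {i : b.support} (hi : i ∈ I) : extSet I :=
  ⟨some i, Set.mem_insert_of_mem _ (Set.mem_image_of_mem _ hi)⟩

@[simp] theorem coe_zeroVertex (I : Set b.support) :
    (zeroVertex I : Option b.support) = none := rfl

@[simp] theorem coe_simpleVertex {I : Set b.support} {i : b.support} (hi : i ∈ I) :
    (simpleVertex hi : Option b.support) = some i := rfl

theorem eq_zeroVertex_or_simpleVertex {I : Set b.support} (x : extSet I) :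
    x = zeroVertex I ∨ ∃ (i : b.support) (hi : i ∈ I), x = simpleVertex hi := by
  obtain ⟨x, rfl | ⟨i, hi, rfl⟩⟩ := x
  · exact Or.inl rfl
  · exact Or.inr ⟨i, hi, rfl⟩

end Vertices

/-! ### The bijection `τ` -/

section Transport

variable {ι₁ M₁ N₁ ι₂ M₂ N₂ : Type*}
  [Fintype ι₁] [AddCommGroup M₁] [Module ℝ M₁] [AddCommGroup N₁] [Module ℝ N₁]
  [Fintype ι₂] [AddCommGroup M₂] [Module ℝ M₂] [AddCommGroup N₂] [Module ℝ N₂]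
  {P₁ : RootPairing ι₁ ℝ M₁ N₁} {b₁ : P₁.Base} {P₂ : RootPairing ι₂ ℝ M₂ N₂} {b₂ : P₂.Base}
  {β₁ : ι₁} {β₂ : ι₂} {I₁ : Set b₁.support} {I₂ : Set b₂.support}
  (f : extSet I₁ ≃ extSet I₂)
  (hf : ∀ x y : extSet I₁, extCartan b₂ β₂ (f x) (f y) = extCartan b₁ β₁ x y)

include hf

/-- The linear extension of `f` preserves pairings with coroots. -/
theorem coroot'_affProj_linExt (u : Finsupp.supported ℝ ℝ (extSet I₁)) (x : extSet I₁) :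
    P₂.coroot' (vertexRoot b₂ β₂ (f x)) (affProj b₂ β₂ (linExt f u)) =
      P₁.coroot' (vertexRoot b₁ β₁ x) (affProj b₁ β₁ u) := by
  induction u using supported_induction with
  | hv y =>
    rw [linExt_vertex]
    simpa [vertex, affProj_single, extCartan] using hf y x
  | h0 => simp
  | hadd u v hu hv => simp only [map_add, Submodule.coe_add, hu, hv]
  | hsmul c u hu => simp only [map_smul, Submodule.coe_smul, hu]

/-- The linear extension of `f` respects root lengths: along the connected set `I₁ ∪ {α₀}` lengths
are determined by the Cartan matrix, starting from the length of `α₀`. -/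
theorem normForm_vertexRoot (hf₀ : f (zeroVertex I₁) = zeroVertex I₂)
    (hconn : ((extGraph b₁ β₁).induce (extSet I₁)).Connected) (x : extSet I₁) :
    normForm P₂ β₂ (P₂.root (vertexRoot b₂ β₂ (f x))) (P₂.root (vertexRoot b₂ β₂ (f x))) =
      normForm P₁ β₁ (P₁.root (vertexRoot b₁ β₁ x)) (P₁.root (vertexRoot b₁ β₁ x)) := by
  let A : Set (Option b₁.support) := {z | ∃ h : z ∈ extSet I₁,
    normForm P₂ β₂ (P₂.root (vertexRoot b₂ β₂ (f ⟨z, h⟩)))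
        (P₂.root (vertexRoot b₂ β₂ (f ⟨z, h⟩))) =
      normForm P₁ β₁ (P₁.root (vertexRoot b₁ β₁ z)) (P₁.root (vertexRoot b₁ β₁ z))}
  have key : A = extSet I₁ := by
    refine (induce_connected_iff.1 hconn).2 A (fun z hz => hz.1)
      ⟨none, Set.mem_insert _ _, ?_⟩ ?_
    · have h0 : f ⟨none, Set.mem_insert _ _⟩ = zeroVertex I₂ := hf₀
      rw [h0, coe_zeroVertex, root_vertexRoot_none, root_vertexRoot_none]
      simp [normForm_self]
    · rintro y ⟨hy, hlen⟩ z hz hzA hadj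
      refine hzA ⟨hz, ?_⟩
      have hsymm : extCartan b₁ β₁ y z = 0 ↔ extCartan b₁ β₁ z y = 0 := pairing_eq_zero_comm
      have hne : extCartan b₁ β₁ y z ≠ 0 := by
        rw [extGraph, SimpleGraph.fromRel_adj] at hadj
        tauto
      have e₁ := two_mul_normForm (P := P₁) β₁ (P₁.root (vertexRoot b₁ β₁ y)) (vertexRoot b₁ β₁ z)
      have e₂ := two_mul_normForm (P := P₁) β₁ (P₁.root (vertexRoot b₁ β₁ z)) (vertexRoot b₁ β₁ y)
      have e₃ := two_mul_normForm (P := P₂) β₂ (P₂.root (vertexRoot b₂ β₂ (f ⟨y, hy⟩)))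
        (vertexRoot b₂ β₂ (f ⟨z, hz⟩))
      have e₄ := two_mul_normForm (P := P₂) β₂ (P₂.root (vertexRoot b₂ β₂ (f ⟨z, hz⟩)))
        (vertexRoot b₂ β₂ (f ⟨y, hy⟩))
      rw [normForm_comm] at e₂ e₄
      rw [RootPairing.root_coroot'_eq_pairing] at e₁ e₂ e₃ e₄
      have f₁ := hf ⟨y, hy⟩ ⟨z, hz⟩
      have f₂ := hf ⟨z, hz⟩ ⟨y, hy⟩
      simp only [extCartan] at f₁ f₂ hne
      rw [f₁] at e₃
      rw [f₂, hlen] at e₄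
      exact mul_left_cancel₀ hne (by rw [← e₃, ← e₁, e₂, e₄])
  obtain ⟨_, h⟩ := key.symm.subset x.2
  exact h

/-- The linear extension of `f` is an isometry. -/
theorem normForm_affProj_linExt
    (hf₀ : f (zeroVertex I₁) = zeroVertex I₂)
    (hconn : ((extGraph b₁ β₁).induce (extSet I₁)).Connected)
    (u v : Finsupp.supported ℝ ℝ (extSet I₁)) :
    normForm P₂ β₂ (affProj b₂ β₂ (linExt f u)) (affProj b₂ β₂ (linExt f v)) =
      normForm P₁ β₁ (affProj b₁ β₁ u) (affProj b₁ β₁ v) := by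
  induction v using supported_induction with
  | hv y =>
    rw [linExt_vertex]
    have e₁ := two_mul_normForm (P := P₁) β₁ (affProj b₁ β₁ u) (vertexRoot b₁ β₁ y)
    have e₂ := two_mul_normForm (P := P₂) β₂ (affProj b₂ β₂ (linExt f u)) (vertexRoot b₂ β₂ (f y))
    rw [coroot'_affProj_linExt f hf, normForm_vertexRoot f hf hf₀ hconn, ← e₁] at e₂
    simpa [vertex, affProj_single] using e₂
  | h0 => simp
  | hadd u v hu hv => simp only [map_add, Submodule.coe_add, hu, hv]
  | hsmul c u hu => simp only [map_smul, Submodule.coe_smul, hu]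

variable [P₁.IsRootSystem] [P₁.IsCrystallographic] [P₁.IsReduced] [P₁.IsIrreducible]
  [P₂.IsRootSystem] [P₂.IsCrystallographic] [P₂.IsReduced] [P₂.IsIrreducible]

omit hf

variable (b₁ β₁ I₁) in
/-- The element `δ - β` of `ℝ(I ∪ {α₀})` for `β ∈ Ψ`. -/
def deltaSub (β : Psi b₁ β₁ I₁) : Finsupp.supported ℝ ℝ (extSet I₁) :=
  ⟨delta b₁ β₁ - affIncl b₁ (P₁.root β), delta_sub_mem b₁ β₁ I₁ β⟩

theorem affProj_deltaSub (β : Psi b₁ β₁ I₁) :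
    affProj b₁ β₁ (deltaSub b₁ β₁ I₁ β) = -P₁.root β := by
  simp only [deltaSub, map_sub, affProj_delta, affProj_affIncl, zero_sub]

/-- The relation `γ = τ(β)`, that is `γ = δ' - f(δ - β)`. -/
def IsTransport (β : Psi b₁ β₁ I₁) (γ : Psi b₂ β₂ I₂) : Prop :=
  affIncl b₂ (P₂.root γ) = delta b₂ β₂ - (linExt f (deltaSub b₁ β₁ I₁ β) : AffSpace b₂)

variable {f}

theorem IsTransport.linExt_deltaSub {β : Psi b₁ β₁ I₁} {γ : Psi b₂ β₂ I₂}
    (h : IsTransport f β γ) : linExt f (deltaSub b₁ β₁ I₁ β) = deltaSub b₂ β₂ I₂ γ := by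
  refine Subtype.ext ?_
  change _ = delta b₂ β₂ - affIncl b₂ (P₂.root γ)
  rw [IsTransport] at h
  rw [h, sub_sub_cancel]

theorem IsTransport.symm {β : Psi b₁ β₁ I₁} {γ : Psi b₂ β₂ I₂}
    (h : IsTransport f β γ) : IsTransport f.symm γ β := by
  rw [IsTransport, ← h.linExt_deltaSub, linExt_symm_linExt]
  simp [deltaSub]

theorem IsTransport.right_unique {β : Psi b₁ β₁ I₁} {γ γ' : Psi b₂ β₂ I₂}
    (h : IsTransport f β γ) (h' : IsTransport f β γ') : γ = γ' := by
  refine Subtype.ext (P₂.root.injective ?_)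
  rw [← affProj_affIncl b₂ β₂ (P₂.root γ), h, ← h', affProj_affIncl]

theorem IsTransport.root_eq {β : Psi b₁ β₁ I₁} {γ : Psi b₂ β₂ I₂}
    (h : IsTransport f β γ) :
    P₂.root γ = -affProj b₂ β₂ (linExt f (deltaSub b₁ β₁ I₁ β)) := by
  rw [h.linExt_deltaSub, affProj_deltaSub, neg_neg]

theorem IsTransport.pairing_eq (hf : ∀ x y : extSet I₁,
      extCartan b₂ β₂ (f x) (f y) = extCartan b₁ β₁ x y)
    {β : Psi b₁ β₁ I₁} {γ : Psi b₂ β₂ I₂} (h : IsTransport f β γ) (x : extSet I₁) :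
    P₂.pairing γ (vertexRoot b₂ β₂ (f x)) = P₁.pairing β (vertexRoot b₁ β₁ x) := by
  rw [← P₂.root_coroot'_eq_pairing, ← P₁.root_coroot'_eq_pairing, h.root_eq, map_neg,
    coroot'_affProj_linExt f hf, affProj_deltaSub, map_neg, neg_neg]

theorem exists_simpleVertex_eq (hf₀ : f (zeroVertex I₁) = zeroVertex I₂)
    {i : b₁.support} (hi : i ∈ I₁) :
    ∃ (j : b₂.support) (hj : j ∈ I₂), f (simpleVertex hi) = simpleVertex hj := by
  refine (eq_zeroVertex_or_simpleVertex (f (simpleVertex hi))).resolve_left fun h => ?_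
  have := congrArg Subtype.val (f.injective (h.trans hf₀.symm))
  simp at this

theorem isTransport_largest (hf₀ : f (zeroVertex I₁) = zeroVertex I₂)
    (h₁ : β₁ ∈ Psi b₁ β₁ I₁) (h₂ : β₂ ∈ Psi b₂ β₂ I₂) :
    IsTransport f ⟨β₁, h₁⟩ ⟨β₂, h₂⟩ := by
  have e : deltaSub b₁ β₁ I₁ ⟨β₁, h₁⟩ = vertex (zeroVertex I₁) :=
    Subtype.ext (by simp [deltaSub, delta, vertex])
  rw [IsTransport, e, linExt_vertex, hf₀]
  simp [vertex, delta]

theorem IsTransport.reflectionPerm (hf₀ : f (zeroVertex I₁) = zeroVertex I₂)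
    (hf : ∀ x y : extSet I₁, extCartan b₂ β₂ (f x) (f y) = extCartan b₁ β₁ x y)
    {β : Psi b₁ β₁ I₁} {γ : Psi b₂ β₂ I₂} (h : IsTransport f β γ)
    {i : b₁.support} (hi : i ∈ I₁) (hβ' : P₁.reflectionPerm i β ∈ Psi b₁ β₁ I₁) :
    ∃ γ' : Psi b₂ β₂ I₂, IsTransport f ⟨P₁.reflectionPerm i β, hβ'⟩ γ' := by
  obtain ⟨j, hj, hij⟩ := exists_simpleVertex_eq hf₀ hi
  refine ⟨⟨P₂.reflectionPerm j γ, reflectionPerm_mem_Psi b₂ γ.2 hj⟩, ?_⟩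
  have hp := h.pairing_eq hf (simpleVertex hi)
  rw [hij] at hp
  simp only [coe_simpleVertex, vertexRoot] at hp
  have e : deltaSub b₁ β₁ I₁ ⟨P₁.reflectionPerm i β, hβ'⟩ = deltaSub b₁ β₁ I₁ β +
      P₁.pairing β i • vertex (simpleVertex hi) := by
    refine Subtype.ext ?_
    simp only [deltaSub, vertex, Submodule.coe_add, Submodule.coe_smul]
    rw [root_reflectionPerm_eq, map_sub, map_smul, affIncl_simple, coe_simpleVertex]
    abel
  rw [IsTransport, e, map_add, map_smul, linExt_vertex, hij]
  simp only [vertex, Submodule.coe_add, Submodule.coe_smul, coe_simpleVertex]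
  rw [root_reflectionPerm_eq, map_sub, map_smul, affIncl_simple, hp]
  rw [IsTransport] at h
  rw [h]
  abel

/-- The element `δ' - f(δ - β)` is a short root in `Ψ₂`. -/
theorem exists_isTransport (hβ₁ : IsLargestShortRoot b₁ Set.univ β₁)
    (hβ₂ : IsLargestShortRoot b₂ Set.univ β₂) (hf₀ : f (zeroVertex I₁) = zeroVertex I₂)
    (hf : ∀ x y : extSet I₁, extCartan b₂ β₂ (f x) (f y) = extCartan b₁ β₁ x y)
    (β : Psi b₁ β₁ I₁) : ∃ γ : Psi b₂ β₂ I₂, IsTransport f β γ := by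
  suffices ∀ h : (β : ι₁) ∈ Psi b₁ β₁ I₁, ∃ γ : Psi b₂ β₂ I₂, IsTransport f ⟨β, h⟩ γ from this β.2
  refine Psi_induction b₁ hβ₁ (p := fun β => ∀ h : β ∈ Psi b₁ β₁ I₁,
    ∃ γ : Psi b₂ β₂ I₂, IsTransport f ⟨β, h⟩ γ) ?_ ?_ β.2
  · exact fun h => ⟨_, isTransport_largest hf₀ h (largest_mem_Psi b₂ hβ₂)⟩
  · intro β hβ ih i hi h
    obtain ⟨γ, hγ⟩ := ih hβ
    exact hγ.reflectionPerm hf₀ hf hi h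

/-- Transport preserves the order: corresponding differences `β' - β` and `f(β' - β)` have the
same coefficients. -/
theorem IsTransport.rootLE (hf₀ : f (zeroVertex I₁) = zeroVertex I₂)
    {β β' : Psi b₁ β₁ I₁} {γ γ' : Psi b₂ β₂ I₂} (h : IsTransport f β γ) (h' : IsTransport f β' γ')
    (hle : RootLE b₁ (P₁.root β) (P₁.root β')) : RootLE b₂ (P₂.root γ) (P₂.root γ') := by
  rw [rootLE_iff] at hle ⊢
  intro j
  by_cases hj : j ∈ I₂
  · obtain ⟨i, hi, hij⟩ := exists_simpleVertex_eq (f := f.symm)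
      (by rw [← hf₀, f.symm_apply_apply]) hj
    have aux {β : Psi b₁ β₁ I₁} {γ : Psi b₂ β₂ I₂} (h : IsTransport f β γ) :
        coeff b₂ (P₂.root γ) j = coeff b₂ (P₂.root β₂) j -
          (coeff b₁ (P₁.root β₁) i - coeff b₁ (P₁.root β) i) := by
      have e := DFunLike.congr_fun h (some j)
      have e' := linExt_apply f (deltaSub b₁ β₁ I₁ β) (simpleVertex hi)
      rw [← hij, f.apply_symm_apply, hij, coe_simpleVertex, coe_simpleVertex, deltaSub,
        Finsupp.sub_apply, affIncl_apply_some, delta_apply_some] at e'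
      rw [Finsupp.sub_apply, affIncl_apply_some, delta_apply_some, deltaSub, e'] at e
      exact e
    rw [aux h, aux h']
    have := hle i
    linarith
  · rw [((mem_Psi_iff b₂).1 γ.2).2 j hj, ((mem_Psi_iff b₂).1 γ'.2).2 j hj]

theorem IsTransport.rootLE_iff (hf₀ : f (zeroVertex I₁) = zeroVertex I₂)
    {β β' : Psi b₁ β₁ I₁} {γ γ' : Psi b₂ β₂ I₂} (h : IsTransport f β γ)
    (h' : IsTransport f β' γ') :
    RootLE b₂ (P₂.root γ) (P₂.root γ') ↔ RootLE b₁ (P₁.root β) (P₁.root β') :=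
  ⟨h.symm.rootLE (by rw [← hf₀, f.symm_apply_apply]) h'.symm, h.rootLE hf₀ h'⟩

theorem IsTransport.normForm_eq (hf₀ : f (zeroVertex I₁) = zeroVertex I₂)
    (hf : ∀ x y : extSet I₁, extCartan b₂ β₂ (f x) (f y) = extCartan b₁ β₁ x y)
    (hconn : ((extGraph b₁ β₁).induce (extSet I₁)).Connected)
    {β β' : Psi b₁ β₁ I₁} {γ γ' : Psi b₂ β₂ I₂} (h : IsTransport f β γ)
    (h' : IsTransport f β' γ') :
    normForm P₂ β₂ (P₂.root γ) (P₂.root γ') = normForm P₁ β₁ (P₁.root β) (P₁.root β') := by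
  have := normForm_affProj_linExt f hf hf₀ hconn (deltaSub b₁ β₁ I₁ β) (deltaSub b₁ β₁ I₁ β')
  rw [h.linExt_deltaSub, h'.linExt_deltaSub] at this
  simpa only [affProj_deltaSub, map_neg, LinearMap.neg_apply, neg_neg] using this

theorem IsTransport.affForm_eq (hf₀ : f (zeroVertex I₁) = zeroVertex I₂)
    (hf : ∀ x y : extSet I₁, extCartan b₂ β₂ (f x) (f y) = extCartan b₁ β₁ x y)
    (hconn : ((extGraph b₁ β₁).induce (extSet I₁)).Connected)
    {β : Psi b₁ β₁ I₁} {γ : Psi b₂ β₂ I₂} (h : IsTransport f β γ) (x : extSet I₁) :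
    affForm b₂ β₂ (affIncl b₂ (P₂.root γ)) (Finsupp.single (f x : Option b₂.support) 1) =
      affForm b₁ β₁ (affIncl b₁ (P₁.root β)) (Finsupp.single (x : Option b₁.support) 1) := by
  have := normForm_affProj_linExt f hf hf₀ hconn (deltaSub b₁ β₁ I₁ β) (vertex x)
  rw [h.linExt_deltaSub, linExt_vertex, affProj_deltaSub, affProj_deltaSub, map_neg, map_neg,
    LinearMap.neg_apply, LinearMap.neg_apply, neg_inj] at this
  simpa only [affForm, LinearMap.BilinForm.comp_apply, affProj_affIncl, vertex] using this

end Transport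

/-! ### Comparison of the two cascades -/

section Comparison

variable {ι₁ M₁ N₁ ι₂ M₂ N₂ : Type*}
  [Fintype ι₁] [AddCommGroup M₁] [Module ℝ M₁] [AddCommGroup N₁] [Module ℝ N₁]
  [Fintype ι₂] [AddCommGroup M₂] [Module ℝ M₂] [AddCommGroup N₂] [Module ℝ N₂]
  {P₁ : RootPairing ι₁ ℝ M₁ N₁} {b₁ : P₁.Base} {P₂ : RootPairing ι₂ ℝ M₂ N₂} {b₂ : P₂.Base}
  {β₁ : ι₁} {β₂ : ι₂} {I₁ : Set b₁.support} {I₂ : Set b₂.support}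
  [P₁.IsRootSystem] [P₁.IsCrystallographic] [P₁.IsReduced] [P₁.IsIrreducible]
  [P₂.IsRootSystem] [P₂.IsCrystallographic] [P₂.IsReduced] [P₂.IsIrreducible]
  (hβ₁ : IsLargestShortRoot b₁ Set.univ β₁) (hβ₂ : IsLargestShortRoot b₂ Set.univ β₂)
  (hI₁ : I₁ ≠ Set.univ) (hI₂ : I₂ ≠ Set.univ)
  (τ : Psi b₁ β₁ I₁ ≃ Psi b₂ β₂ I₂)
  (hle : ∀ β β' : Psi b₁ β₁ I₁,
    RootLE b₂ (P₂.root (τ β)) (P₂.root (τ β')) ↔ RootLE b₁ (P₁.root β) (P₁.root β'))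
  (hperp : ∀ β β' : Psi b₁ β₁ I₁, P₂.pairing (τ β) (τ β') = 0 ↔ P₁.pairing β β' = 0)

include hβ₁ hβ₂ hI₁ hI₂ hle hperp

/-- A bijection of the sets `Ψ` that preserves order and orthogonality preserves membership in the
cascade, by descending induction. -/
theorem mem_cascade_apply_iff (β : Psi b₁ β₁ I₁) :
    (τ β : ι₂) ∈ cascade b₂ ↔ (β : ι₁) ∈ cascade b₁ := by
  by_contra hβ
  obtain ⟨γ, hγ, hmax⟩ := Set.exists_max_image
    {β : Psi b₁ β₁ I₁ | ¬ ((τ β : ι₂) ∈ cascade b₂ ↔ (β : ι₁) ∈ cascade b₁)}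
    (fun β => ht b₁ (P₁.root β)) (Set.toFinite _) ⟨β, hβ⟩
  refine hγ ?_
  have ih (y : Psi b₁ β₁ I₁) (h : RootLE b₁ (P₁.root γ) (P₁.root y)) (hne : γ ≠ y) :
      (τ y : ι₂) ∈ cascade b₂ ↔ (y : ι₁) ∈ cascade b₁ := by
    by_contra hy
    exact absurd (hmax y hy) (not_le.2 (ht_lt_of_rootLE b₁ h fun e => hne (Subtype.ext e)))
  rw [mem_cascade_iff_orthogonal b₂ hβ₂ hI₂ (τ γ).2, mem_cascade_iff_orthogonal b₁ hβ₁ hI₁ γ.2]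
  constructor
  · intro h y hyΨ hy hγy hne
    have hne' : γ ≠ ⟨y, hyΨ⟩ := fun e => hne (congrArg Subtype.val e)
    refine (hperp γ ⟨y, hyΨ⟩).1 (h _ (τ ⟨y, hyΨ⟩).2 ((ih ⟨y, hyΨ⟩ hγy hne').2 hy)
      ((hle _ _).2 hγy) ?_)
    exact fun e => hne' (τ.injective (Subtype.ext e))
  · intro h z hzΨ hz hγz hne
    obtain ⟨y, hy⟩ := τ.surjective ⟨z, hzΨ⟩
    obtain rfl : (τ y : ι₂) = z := congrArg Subtype.val hy
    have hγy := (hle γ y).1 hγz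
    have hne' : γ ≠ y := fun e => hne (by rw [e])
    exact (hperp γ y).2 (h y y.2 ((ih y hγy hne').1 hz) hγy fun e => hne' (Subtype.ext e))

theorem isPredecessor_apply_iff {β β' : Psi b₁ β₁ I₁} (hβ : (β : ι₁) ∈ cascade b₁)
    (hβ' : (β' : ι₁) ∈ cascade b₁) :
    IsPredecessor b₁ (β : ι₁) β' ↔ IsPredecessor b₂ (τ β : ι₂) (τ β') := by
  have hK := mem_cascade_apply_iff hβ₁ hβ₂ hI₁ hI₂ τ hle hperp
  have hinj (x y : Psi b₁ β₁ I₁) : (τ x : ι₂) = τ y ↔ (x : ι₁) = y := by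
    rw [← Subtype.ext_iff, ← Subtype.ext_iff, τ.injective.eq_iff]
  rw [isPredecessor_iff b₁ hβ₁ hI₁ hβ β.2 hβ' β'.2,
    isPredecessor_iff b₂ hβ₂ hI₂ ((hK β).2 hβ) (τ β).2 ((hK β').2 hβ') (τ β').2,
    hle, Ne, Ne, hinj]
  refine and_congr_right fun _ => ⟨fun h z hzΨ hz h1 h2 => ?_, fun h y hyΨ hy h1 h2 => ?_⟩
  · obtain ⟨y, hy⟩ := τ.surjective ⟨z, hzΨ⟩
    obtain rfl : (τ y : ι₂) = z := congrArg Subtype.val hy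
    rw [hinj, hinj]
    exact h y y.2 ((hK y).1 hz) ((hle _ _).1 h1) ((hle _ _).1 h2)
  · have := h _ (τ ⟨y, hyΨ⟩).2 ((hK ⟨y, hyΨ⟩).2 hy) ((hle _ _).2 h1) ((hle _ _).2 h2)
    rwa [hinj, hinj] at this

end Comparison

end

end KostantCascade

open KostantCascade in
theorem proposition26
    {ι₁ M₁ N₁ ι₂ M₂ N₂ : Type*}
    [Fintype ι₁] [AddCommGroup M₁] [Module ℝ M₁] [AddCommGroup N₁] [Module ℝ N₁]
    [Fintype ι₂] [AddCommGroup M₂] [Module ℝ M₂] [AddCommGroup N₂] [Module ℝ N₂]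
    -- two indecomposable finite (reduced, crystallographic) root systems with bases
    (P₁ : RootPairing ι₁ ℝ M₁ N₁) [P₁.IsRootSystem] [P₁.IsCrystallographic] [P₁.IsReduced]
    [P₁.IsIrreducible] (b₁ : P₁.Base)
    (P₂ : RootPairing ι₂ ℝ M₂ N₂) [P₂.IsRootSystem] [P₂.IsCrystallographic] [P₂.IsReduced]
    [P₂.IsIrreducible] (b₂ : P₂.Base)
    -- their largest short roots
    (β₁ : ι₁) (hβ₁ : IsLargestShortRoot b₁ Set.univ β₁)
    (β₂ : ι₂) (hβ₂ : IsLargestShortRoot b₂ Set.univ β₂)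
    -- proper sets of simple roots that are connected together with the extra vertex
    (I₁ : Set b₁.support) (hI₁ : I₁ ≠ Set.univ)
    (hconn₁ : ((extGraph b₁ β₁).induce (extSet I₁)).Connected)
    (I₂ : Set b₂.support) (hI₂ : I₂ ≠ Set.univ)
    (hconn₂ : ((extGraph b₂ β₂).induce (extSet I₂)).Connected)
    -- an isomorphism of Dynkin diagrams that respects the extra vertex
    (f : extSet I₁ ≃ extSet I₂)
    (hf₀ : (f ⟨none, Set.mem_insert _ _⟩ : Option b₂.support) = none)
    (hf : ∀ x y : extSet I₁, extCartan b₂ β₂ (f x) (f y) = extCartan b₁ β₁ x y) :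
    ∃ τ : Psi b₁ β₁ I₁ ≃ Psi b₂ β₂ I₂,
      -- `τ(β) = δ' - (δ - β)`, where `δ - β` is transported by the linear extension of `f`
      (∀ β : Psi b₁ β₁ I₁,
        affIncl b₂ (P₂.root (τ β)) =
          delta b₂ β₂ - (linExt f ⟨delta b₁ β₁ - affIncl b₁ (P₁.root β),
            delta_sub_mem b₁ β₁ I₁ β⟩ : AffSpace b₂)) ∧
      -- compatibility with the scalar products
      (∀ (β : Psi b₁ β₁ I₁) (x : extSet I₁),
        affForm b₂ β₂ (affIncl b₂ (P₂.root (τ β))) (Finsupp.single (f x : Option b₂.support) 1) =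
          affForm b₁ β₁ (affIncl b₁ (P₁.root β)) (Finsupp.single (x : Option b₁.support) 1)) ∧
      (∀ β β' : Psi b₁ β₁ I₁,
        normForm P₂ β₂ (P₂.root (τ β)) (P₂.root (τ β')) =
          normForm P₁ β₁ (P₁.root β) (P₁.root β')) ∧
      -- `τ` maps the cascade elements in `Ψ₁` onto the cascade elements in `Ψ₂`
      τ '' {β : Psi b₁ β₁ I₁ | (β : ι₁) ∈ cascade b₁} =
        {γ : Psi b₂ β₂ I₂ | (γ : ι₂) ∈ cascade b₂} ∧
      -- `τ` preserves predecessors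
      (∀ β β' : Psi b₁ β₁ I₁, (β : ι₁) ∈ cascade b₁ → (β' : ι₁) ∈ cascade b₁ →
        (IsPredecessor b₁ β β' ↔ IsPredecessor b₂ (τ β) (τ β'))) ∧
      -- the cascade elements in `Ψ₁` form a predecessor chain starting at `β₁`, and `τ` maps it to
      -- the predecessor chain of the cascade elements in `Ψ₂`, starting at the largest short root
      (∃ (r : ℕ) (c : Fin (r + 1) → Psi b₁ β₁ I₁),
        Function.Injective c ∧
        Set.range c = {β : Psi b₁ β₁ I₁ | (β : ι₁) ∈ cascade b₁} ∧
        (c 0 : ι₁) = β₁ ∧ (τ (c 0) : ι₂) = β₂ ∧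
        ∀ j : Fin r, IsPredecessor b₁ (c j.castSucc) (c j.succ) ∧
          IsPredecessor b₂ (τ (c j.castSucc)) (τ (c j.succ))) := by
  have hf₀' : f (zeroVertex I₁) = zeroVertex I₂ := Subtype.ext hf₀
  have hf₀s : f.symm (zeroVertex I₂) = zeroVertex I₁ := by rw [← hf₀', f.symm_apply_apply]
  have hfs : ∀ x y : extSet I₂, extCartan b₁ β₁ (f.symm x) (f.symm y) = extCartan b₂ β₂ x y :=
    fun x y => by rw [← hf, f.apply_symm_apply, f.apply_symm_apply]
  choose t ht using exists_isTransport (f := f) hβ₁ hβ₂ hf₀' hf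
  choose s hs using exists_isTransport (f := f.symm) hβ₂ hβ₁ hf₀s hfs
  let τ : Psi b₁ β₁ I₁ ≃ Psi b₂ β₂ I₂ :=
    ⟨t, s, fun β => (hs (t β)).right_unique (ht β).symm,
      fun γ => (ht (s γ)).right_unique (hs γ).symm⟩
  have hτ (β : Psi b₁ β₁ I₁) : IsTransport f β (τ β) := ht β
  have hle (β β' : Psi b₁ β₁ I₁) :
      RootLE b₂ (P₂.root (τ β)) (P₂.root (τ β')) ↔ RootLE b₁ (P₁.root β) (P₁.root β') :=
    (hτ β).rootLE_iff hf₀' (hτ β')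
  have hform (β β' : Psi b₁ β₁ I₁) :
      normForm P₂ β₂ (P₂.root (τ β)) (P₂.root (τ β')) =
        normForm P₁ β₁ (P₁.root β) (P₁.root β') :=
    (hτ β).normForm_eq hf₀' hf hconn₁ (hτ β')
  have hperp (β β' : Psi b₁ β₁ I₁) : P₂.pairing (τ β) (τ β') = 0 ↔ P₁.pairing β β' = 0 := by
    rw [pairing_eq_zero_iff_normForm β₂, pairing_eq_zero_iff_normForm β₁, hform]
  have hK := mem_cascade_apply_iff hβ₁ hβ₂ hI₁ hI₂ τ hle hperp
  have hpred {β β' : Psi b₁ β₁ I₁} (h : (β : ι₁) ∈ cascade b₁) (h' : (β' : ι₁) ∈ cascade b₁) :=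
    isPredecessor_apply_iff hβ₁ hβ₂ hI₁ hI₂ τ hle hperp h h'
  refine ⟨τ, hτ, fun β x => (hτ β).affForm_eq hf₀' hf hconn₁ x, hform, ?_,
    fun β β' h h' => hpred h h', ?_⟩
  · ext γ
    constructor
    · rintro ⟨β, hβ, rfl⟩
      exact (hK β).2 hβ
    · intro hγ
      obtain ⟨β, rfl⟩ := τ.surjective γ
      exact ⟨β, (hK β).1 hγ, rfl⟩
  · obtain ⟨r, c, hinj, hrange, h0, hc⟩ := exists_predecessor_chain b₁ hβ₁ hI₁
    have hmem (j : Fin (r + 1)) : (c j : ι₁) ∈ cascade b₁ := hrange.subset ⟨j, rfl⟩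
    refine ⟨r, c, hinj, hrange, h0, ?_, fun j => ⟨hc j, (hpred (hmem _) (hmem _)).1 (hc j)⟩⟩
    have e : c 0 = ⟨β₁, largest_mem_Psi b₁ hβ₁⟩ := Subtype.ext h0
    rw [e]
    exact congrArg Subtype.val
      ((hτ _).right_unique (isTransport_largest hf₀' _ (largest_mem_Psi b₂ hβ₂)))
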